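/- Let $\mathbb{k}$ be any field, let $n\ge 2$ and $i\ge 0$ be integers, and let $M=U_{2,n}$ be the uniform matroid of rank two on $E=\{1,\dots,n\}$, whose circuits are the $3$-element subsets of $E$. Let $V$ have $\mathbb{k}$-basis $x_1,\dots,x_n$. Let $$A=\mathrm{OS}(M)=\textstyle\bigwedge(x_1,\dots,x_n)\big/\big(x_b\wedge x_c-x_a\wedge x_c+x_a\wedge x_b:\ \{a,b,c\}\text{ a circuit}\big)$$ be its Orlik-Solomon algebra over $\mathbb{k}$, written as $A=T(V)/I$. Its quadratic dual is $A^!=\mathrm{OS}(M)^!=T(V^*)/J$, where $J$ is the two-sided ideal generated by $I_2^{\perp}\subseteq V^*\otimes V^*$, the annihilator of $I_2=I\cap (V\otimes V)$. The symmetric group $\mathfrak S_n$ acts on $A$ by $\sigma(x_j)=x_{\sigma(j)}$ and contragrediently on $V^*$; hence it acts on $A^!$ and on each homogeneous component $A^!_i=\mathrm{OS}(M)^!_i$ (the image of $T^i(V^*)$). Let $R_{\mathbb{k}}(\mathfrak S_n)$ be the Grothendieck ring of finite-dimensional $\mathbb{k}\mathfrak S_n$-modules: the free abelian group on isomorphism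 classes $[V]$ modulo the relations $[V]=[U]+[W]$ for all short exact sequences $0\to U\to V\to W\to 0$, with product $[V]\cdot[W]=[V\otimes_{\mathbb{k}} W]$. Let $$\mathcal S^{(n-1,1)}=\{x\in\mathbb{k}^n: x_1+\cdots+x_n=0\},$$ and let $\varphi_\lambda=\big[\mathbb{k}[\mathfrak S_n/\mathfrak S_\lambda]\big]$ be the class of the permutation representation on the cosets of the Young subgroup $\mathfrak S_\lambda=\mathfrak S_{\lambda_1}\times\cdots\times\mathfrak S_{\lambda_\ell}$ for $\lambda_1+\cdots+\lambda_\ell=n$, with the convention that $\varphi_{(n-d,1^d)}=0$ if $d>n$. Let $S(m,r)$ denote the Stirling numbers of the second kind. Then in $R_{\mathbb{k}}(\mathfrak S_n)$ one has $$[\mathrm{OS}(M)^!_i]=\sum_{k=0}^i[\mathcal S^{(n-1,1)}]^k .$$ This element is the class of a permutation representation, that is, it equals $[\mathbb{k}[X]]$ for some finite $\mathfrak S_n$-set $X$, and $$[\mathrm{OS}(M)^!_i]=\begin{cases}\varphi_{(n)}+\displaystyle\sum_{d=2}^i a_{d,i}\,\varphi_{(n-d,1^d)}, & i\text{ even},\\[2mm]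 \varphi_{(n-1,1)}+\displaystyle\sum_{d=2}^i b_{d,i}\,\varphi_{(n-d,1^d)}, & i\text{ odd},\end{cases}$$ where, for $2\le d\le i$, the coefficients are positive integers independent of $n$, given by $$a_{d,i}=\sum_{k=\lfloor d/2\rfloor}^{i/2}S(2k-1,d-1)\ \ (i\text{ even}),\qquad b_{d,i}=\sum_{k=\lfloor (d-1)/2\rfloor}^{(i-1)/2}S(2k,d-1)\ \ (i\text{ odd}).$$ -/

import Mathlib

open CategoryTheory MonoidalCategory TensorProduct

namespace RankTwoOS

noncomputable section

universe u v

section GrothendieckRing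

variable (k : Type u) [Field k] (G : Type v) [Group G]

/-- The free abelian group on the isomorphism classes of finite-dimensional `k G`-modules; it is a
commutative ring, in which the product of two basis elements is the class of the tensor product. -/
abbrev FreeRepRing : Type (max (u + 1) v) :=
  FreeAbelianGroup (Skeleton (FDRep k G))

variable {k G}

/-- `0 → U → V → W → 0` is a short exact sequence of `k G`-modules. -/
structure IsShortExactSeq {U V W : FDRep k G} (f : U →ₗ[k] V) (g : V →ₗ[k] W) : Prop where
  comm_left : ∀ (s : G) (x : U), f (U.ρ s x) = V.ρ s (f x)
  comm_right : ∀ (s : G) (x : V), g (V.ρ s x) = W.ρ s (g x)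
  injective : Function.Injective f
  exact : Function.Exact f g
  surjective : Function.Surjective g

variable (k G)

/-- The elements `[V] - ([U] + [W])`, for all short exact sequences `0 → U → V → W → 0`. -/
def grothendieckRelations : Set (FreeRepRing k G) :=
  {x | ∃ (U V W : FDRep k G) (f : U →ₗ[k] V) (g : V →ₗ[k] W), IsShortExactSeq f g ∧
    x = FreeAbelianGroup.of (toSkeleton V) -
      (FreeAbelianGroup.of (toSkeleton U) + FreeAbelianGroup.of (toSkeleton W))}

variable {k G}

theorem tensor_rho (A B : FDRep k G) (g : G) :
    (A ⊗ B : FDRep k G).ρ g = TensorProduct.map (A.ρ g) (B.ρ g) := rfl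

theorem mul_mem_grothendieckRelations (S : Skeleton (FDRep k G)) (x : FreeRepRing k G)
    (hx : x ∈ grothendieckRelations k G) :
    FreeAbelianGroup.of S * x ∈ grothendieckRelations k G := by
  obtain ⟨U, V, W, f, g, h, rfl⟩ := hx
  obtain ⟨A, rfl⟩ : ∃ A : FDRep k G, toSkeleton A = S := Quotient.exists_rep S
  refine ⟨A ⊗ U, A ⊗ V, A ⊗ W, LinearMap.lTensor A f, LinearMap.lTensor A g,
    ⟨?_, ?_, ?_, ?_, ?_⟩, ?_⟩
  · intro s x
    have : (LinearMap.lTensor A f) ∘ₗ (TensorProduct.map (A.ρ s) (U.ρ s)) =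
        (TensorProduct.map (A.ρ s) (V.ρ s)) ∘ₗ (LinearMap.lTensor A f) := by
      apply TensorProduct.ext'
      intro a b
      simp [h.comm_left]
    exact LinearMap.congr_fun this x
  · intro s x
    have : (LinearMap.lTensor A g) ∘ₗ (TensorProduct.map (A.ρ s) (V.ρ s)) =
        (TensorProduct.map (A.ρ s) (W.ρ s)) ∘ₗ (LinearMap.lTensor A g) := by
      apply TensorProduct.ext'
      intro a b
      simp [h.comm_right]
    exact LinearMap.congr_fun this x
  · exact Module.Flat.lTensor_preserves_injective_linearMap f h.injective
  · exact lTensor_exact A h.exact h.surjective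
  · exact LinearMap.lTensor_surjective A h.surjective
  · simp only [Skeleton.toSkeleton_tensorObj, FreeAbelianGroup.of_mul, mul_sub, mul_add]

variable (k G)

/-- The `ℤ`-span of the relations coming from short exact sequences. Tensoring over the field `k`
is exact, so this `ℤ`-span is an ideal. -/
def grothendieckIdeal : Ideal (FreeRepRing k G) where
  __ := AddSubgroup.closure (grothendieckRelations k G)
  smul_mem' c x hx := by
    change c * x ∈ AddSubgroup.closure (grothendieckRelations k G)
    change x ∈ AddSubgroup.closure (grothendieckRelations k G) at hx
    induction c using FreeAbelianGroup.induction_on with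
    | zero => rw [zero_mul]; exact zero_mem _
    | of S =>
      induction hx using AddSubgroup.closure_induction with
      | mem y hy => exact AddSubgroup.subset_closure (mul_mem_grothendieckRelations S y hy)
      | zero => rw [mul_zero]; exact zero_mem _
      | add y z _ _ h1 h2 => rw [mul_add]; exact add_mem h1 h2
      | neg y _ h1 => rw [mul_neg]; exact neg_mem h1
    | neg S h1 => rw [neg_mul]; exact neg_mem h1
    | add a b h1 h2 => rw [add_mul]; exact add_mem h1 h2

/-- The Grothendieck ring `R_k(G)` of finite-dimensional `k G`-modules. -/
abbrev GrothendieckRing : Type (max (u + 1) v) :=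
  FreeRepRing k G ⧸ grothendieckIdeal k G

variable {k G}

/-- The class `[V]` in `R_k(G)` of a finite-dimensional representation. -/
def repClass {V : Type u} [AddCommGroup V] [Module k V] [Module.Finite k V]
    (ρ : Representation k G V) : GrothendieckRing k G :=
  Ideal.Quotient.mk (grothendieckIdeal k G) (FreeAbelianGroup.of (toSkeleton (FDRep.of ρ)))

variable (k G)

/-- The class in `R_k(G)` of the permutation representation `k[X]` of a finite `G`-set `X`. -/
def permClass (X : Type) [Finite X] [MulAction G X] : GrothendieckRing k G :=
  repClass (Representation.ofMulAction k G X)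

variable {k G} in
/-- The class in `R_k(G)` of a finite-dimensional subrepresentation. -/
def subrepClass {V : Type u} [AddCommGroup V] [Module k V] {ρ : Representation k G V}
    (σ : Subrepresentation ρ) [Module.Finite k σ.toSubmodule] : GrothendieckRing k G :=
  repClass (V := σ.toSubmodule) σ.toRepresentation

end GrothendieckRing

section QuadraticDual

variable {k : Type u} [Field k]

/-- The inclusion `V ⊗ V → T(V)` of the tensors of degree two. -/
def degreeTwo (k : Type u) [Field k] (V : Type u) [AddCommGroup V] [Module k V] :
    V ⊗[k] V →ₗ[k] TensorAlgebra k V :=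
  LinearMap.mul' k (TensorAlgebra k V) ∘ₗ
    TensorProduct.map (TensorAlgebra.ι k) (TensorAlgebra.ι k)

variable {V : Type u} [AddCommGroup V] [Module k V]

/-- For an algebra `A = T(V)/I`, presented by the quotient map `π : T(V) → A` with kernel `I`,
this is `I₂ = I ∩ (V ⊗ V)`. -/
def quadraticPart {A : Type u} [Ring A] [Algebra k A] (π : TensorAlgebra k V →ₐ[k] A) :
    Submodule k (V ⊗[k] V) :=
  LinearMap.ker (π.toLinearMap ∘ₗ degreeTwo k V)

variable (I₂ : Submodule k (V ⊗[k] V))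

/-- The relations `p = 0`, for all `p` in `J₂ = I₂^⊥ ⊆ V^* ⊗ V^*`, where the pairing of `V^* ⊗ V^*`
with `V ⊗ V` is `(y ⊗ y', x ⊗ x') = y(x) y'(x')`. -/
inductive QuadraticDualRel :
    TensorAlgebra k (Module.Dual k V) → TensorAlgebra k (Module.Dual k V) → Prop
  | of (p : Module.Dual k V ⊗[k] Module.Dual k V)
      (hp : ∀ q ∈ I₂, TensorProduct.dualDistrib k V V p q = 0) :
      QuadraticDualRel (degreeTwo k (Module.Dual k V) p) 0

/-- The quadratic dual `A^! = T(V^*)/J`, where `J` is the two-sided ideal generated by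
`J₂ = I₂^⊥`. -/
abbrev QuadraticDual : Type u := RingQuot (QuadraticDualRel I₂)

/-- The quotient map `T(V^*) → A^!`. -/
def quadraticDualMk : TensorAlgebra k (Module.Dual k V) →ₐ[k] QuadraticDual I₂ :=
  RingQuot.mkAlgHom k (QuadraticDualRel I₂)

/-- The homogeneous component `A^!_i`, that is, the image of `T^i(V^*)`. -/
def quadraticDualPiece (i : ℕ) : Submodule k (QuadraticDual I₂) :=
  (LinearMap.range (TensorAlgebra.ι k (M := Module.Dual k V)) ^ i).map
    (quadraticDualMk I₂).toLinearMap

instance [Module.Finite k V] (i : ℕ) : Module.Finite k (quadraticDualPiece I₂ i) := by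
  rw [Module.Finite.iff_fg]
  refine Submodule.FG.map _ (Submodule.FG.pow ?_ i)
  rw [LinearMap.range_eq_map]
  exact Submodule.FG.map _ Module.Finite.fg_top

variable {G : Type v} [Group G] (ρ : Representation k G V)

/-- The contragredient action of `g` on `T(V^*)`, by algebra automorphisms. -/
def tensorDualAct (g : G) :
    TensorAlgebra k (Module.Dual k V) →ₐ[k] TensorAlgebra k (Module.Dual k V) :=
  TensorAlgebra.lift k (TensorAlgebra.ι k ∘ₗ ρ.dual g)

theorem tensorDualAct_ι (g : G) (y : Module.Dual k V) :
    tensorDualAct ρ g (TensorAlgebra.ι k y) = TensorAlgebra.ι k (ρ.dual g y) := by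
  simp [tensorDualAct]

theorem tensorDualAct_degreeTwo (g : G) (p : Module.Dual k V ⊗[k] Module.Dual k V) :
    tensorDualAct ρ g (degreeTwo k _ p) =
      degreeTwo k _ (TensorProduct.map (ρ.dual g) (ρ.dual g) p) := by
  induction p with
  | zero => simp
  | add a b ha hb => simp [ha, hb]
  | tmul a b => simp [degreeTwo, tensorDualAct_ι]

theorem dualDistrib_map_dual (g : G) (p : Module.Dual k V ⊗[k] Module.Dual k V)
    (q : V ⊗[k] V) :
    TensorProduct.dualDistrib k V V (TensorProduct.map (ρ.dual g) (ρ.dual g) p) q =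
      TensorProduct.dualDistrib k V V p (TensorProduct.map (ρ g⁻¹) (ρ g⁻¹) q) := by
  induction p with
  | zero => simp
  | add a b ha hb => rw [map_add, map_add, map_add, LinearMap.add_apply, LinearMap.add_apply, ha, hb]
  | tmul a b =>
    induction q with
    | zero => simp
    | add c d hc hd => rw [map_add, map_add, hc, hd, map_add]
    | tmul c d => rfl

variable {I₂} in
/-- If `I₂` is stable under `G`, then so is `J₂ = I₂^⊥`, and `G` acts on `A^!`. -/
def quadraticDualAct (hI : ∀ g : G, ∀ q ∈ I₂, TensorProduct.map (ρ g) (ρ g) q ∈ I₂) (g : G) :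
    QuadraticDual I₂ →ₐ[k] QuadraticDual I₂ :=
  RingQuot.liftAlgHom k ⟨(quadraticDualMk I₂).comp (tensorDualAct ρ g), by
    rintro _ _ ⟨p, hp⟩
    rw [map_zero, AlgHom.comp_apply, tensorDualAct_degreeTwo, ← map_zero (quadraticDualMk I₂)]
    refine RingQuot.mkAlgHom_rel k (QuadraticDualRel.of _ fun q hq => ?_)
    rw [dualDistrib_map_dual]
    exact hp _ (hI g⁻¹ q hq)⟩

variable (hI : ∀ g : G, ∀ q ∈ I₂, TensorProduct.map (ρ g) (ρ g) q ∈ I₂)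

theorem quadraticDualAct_mk (g : G) (t : TensorAlgebra k (Module.Dual k V)) :
    quadraticDualAct ρ hI g (quadraticDualMk I₂ t) =
      quadraticDualMk I₂ (tensorDualAct ρ g t) := by
  simp [quadraticDualAct, quadraticDualMk]

/-- The representation of `G` on `A^!` by graded algebra automorphisms which extends the
contragredient representation `V^*`. -/
def quadraticDualRep : Representation k G (QuadraticDual I₂) where
  toFun g := (quadraticDualAct ρ hI g).toLinearMap
  map_one' := by
    have : quadraticDualAct ρ hI 1 = AlgHom.id k _ := by
      refine RingQuot.ringQuot_ext' k _ _ (TensorAlgebra.hom_ext (LinearMap.ext fun y => ?_))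
      have h := quadraticDualAct_mk I₂ ρ hI 1 (TensorAlgebra.ι k y)
      rw [tensorDualAct_ι, map_one] at h
      exact h
    rw [this]; rfl
  map_mul' g h := by
    have : quadraticDualAct ρ hI (g * h) =
        (quadraticDualAct ρ hI g).comp (quadraticDualAct ρ hI h) := by
      refine RingQuot.ringQuot_ext' k _ _ (TensorAlgebra.hom_ext (LinearMap.ext fun y => ?_))
      change quadraticDualAct ρ hI (g * h) (quadraticDualMk I₂ (TensorAlgebra.ι k y)) =
        quadraticDualAct ρ hI g
          (quadraticDualAct ρ hI h (quadraticDualMk I₂ (TensorAlgebra.ι k y)))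
      simp only [quadraticDualAct_mk, tensorDualAct_ι, map_mul]
      rfl
    rw [this]; rfl

/-- The component `A^!_i` as a subrepresentation of `A^!`. -/
def quadraticDualPieceRep (i : ℕ) : Subrepresentation (quadraticDualRep I₂ ρ hI) where
  toSubmodule := quadraticDualPiece I₂ i
  apply_mem_toSubmodule g v hv := by
    obtain ⟨t, ht, rfl⟩ := hv
    refine ⟨tensorDualAct ρ g t, ?_, (quadraticDualAct_mk I₂ ρ hI g t).symm⟩
    have h1 : (LinearMap.range (TensorAlgebra.ι k (M := Module.Dual k V)) ^ i).map
        (tensorDualAct ρ g).toLinearMap ≤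
          LinearMap.range (TensorAlgebra.ι k (M := Module.Dual k V)) ^ i := by
      rw [Submodule.map_pow]
      refine pow_le_pow_left' ?_ i
      rintro _ ⟨_, ⟨y, rfl⟩, rfl⟩
      exact ⟨ρ.dual g y, (tensorDualAct_ι ρ g y).symm⟩
    exact h1 ⟨t, ht, rfl⟩

instance [Module.Finite k V] (i : ℕ) :
    Module.Finite k (quadraticDualPieceRep I₂ ρ hI i).toSubmodule :=
  inferInstanceAs (Module.Finite k (quadraticDualPiece I₂ i))

end QuadraticDual

section OrlikSolomon

variable (k : Type u) [Field k] {α : Type} (M : Matroid α)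

/-- The vector space `V` with basis `x_e`, for `e` in `α`. -/
abbrev VarSpace (α : Type) : Type u := MonoidAlgebra k α

/-- `∂ x_C = ∑_j (-1)^j x_{c_0} ∧ ⋯ (omit x_{c_j}) ⋯ ∧ x_{c_m}` for `C = {c_0, …, c_m}`. -/
def osBoundary {m : ℕ} (c : Fin (m + 1) → α) : ExteriorAlgebra k (VarSpace k α) :=
  ∑ j : Fin (m + 1), (-1 : k) ^ (j : ℕ) •
    ExteriorAlgebra.ιMulti k m fun i : Fin m =>
      (MonoidAlgebra.single (c (j.succAbove i)) 1 : VarSpace k α)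

/-- The relations `∂ x_C = 0` for all circuits `C` of `M`. All listings of the elements of `C` are
allowed; another listing only changes the sign of `∂ x_C`. -/
inductive OSRel :
    ExteriorAlgebra k (VarSpace k α) → ExteriorAlgebra k (VarSpace k α) → Prop
  | of {m : ℕ} (c : Fin (m + 1) → α) (hc : Function.Injective c)
      (hC : M.IsCircuit (Set.range c)) : OSRel (osBoundary k c) 0

/-- The Orlik-Solomon algebra of `M`. -/
abbrev OrlikSolomonAlgebra : Type u := RingQuot (OSRel k M)

/-- The presentation of the Orlik-Solomon algebra as a quotient of the tensor algebra. -/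
def osPresentation : TensorAlgebra k (VarSpace k α) →ₐ[k] OrlikSolomonAlgebra k M :=
  (RingQuot.mkAlgHom k (OSRel k M)).comp TensorAlgebra.toExterior

/-- `G` acts on `M` by matroid automorphisms. -/
def ActsByAutomorphisms (G : Type v) [Group G] [MulAction G α] : Prop :=
  ∀ (g : G) (C : Set α), M.IsCircuit C → M.IsCircuit ((fun a => g • a) '' C)

variable {G : Type v} [Group G] [MulAction G α]

theorem map_osBoundary (g : G) {m : ℕ} (c : Fin (m + 1) → α) :
    ExteriorAlgebra.map (Representation.ofMulAction k G α g) (osBoundary k c) =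
      osBoundary k (fun i => g • c i) := by
  simp only [osBoundary, map_sum, map_smul, ExteriorAlgebra.map_apply_ιMulti]
  refine Finset.sum_congr rfl fun j _ => ?_
  congr 2
  funext i
  simp

variable {M}

/-- The action of `g` on the Orlik-Solomon algebra, by `x_e ↦ x_{g e}`. -/
def osAct (hM : ActsByAutomorphisms M G) (g : G) :
    OrlikSolomonAlgebra k M →ₐ[k] OrlikSolomonAlgebra k M :=
  RingQuot.liftAlgHom k ⟨(RingQuot.mkAlgHom k (OSRel k M)).comp
    (ExteriorAlgebra.map (Representation.ofMulAction k G α g)), by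
    rintro _ _ ⟨c, hc, hC⟩
    rw [map_zero, AlgHom.comp_apply, map_osBoundary, ← map_zero (RingQuot.mkAlgHom k (OSRel k M))]
    refine RingQuot.mkAlgHom_rel k (OSRel.of _ ((MulAction.injective g).comp hc) ?_)
    have := hM g _ hC
    rwa [← Set.range_comp] at this⟩

theorem osPresentation_degreeTwo_map (hM : ActsByAutomorphisms M G) (g : G)
    (q : VarSpace k α ⊗[k] VarSpace k α) :
    osPresentation k M (degreeTwo k _ (TensorProduct.map (Representation.ofMulAction k G α g)
      (Representation.ofMulAction k G α g) q)) =
      osAct k hM g (osPresentation k M (degreeTwo k _ q)) := by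
  induction q with
  | zero => simp
  | add a b ha hb => simp only [map_add, ha, hb]
  | tmul a b =>
    simp [degreeTwo, osPresentation, osAct, RingQuot.liftAlgHom_mkAlgHom_apply]

theorem quadraticPart_stable (hM : ActsByAutomorphisms M G) (g : G) :
    ∀ q ∈ quadraticPart (osPresentation k M),
      TensorProduct.map (Representation.ofMulAction k G α g)
        (Representation.ofMulAction k G α g) q ∈ quadraticPart (osPresentation k M) := by
  intro q hq
  have hq' : osPresentation k M (degreeTwo k _ q) = 0 := hq
  change osPresentation k M (degreeTwo k _ _) = 0
  rw [osPresentation_degreeTwo_map k hM, hq', map_zero]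

/-- The class `[OS(M)^!_i]` in `R_k(G)`, for a group `G` of automorphisms of `M`. -/
def osDualClass [Finite α] (hM : ActsByAutomorphisms M G) (i : ℕ) : GrothendieckRing k G :=
  subrepClass (quadraticDualPieceRep (quadraticPart (osPresentation k M))
    (Representation.ofMulAction k G α) (quadraticPart_stable k hM) i)

end OrlikSolomon

section Uniform

/-- The uniform matroid `U_{r,n}` on the ground set `Fin n`: a set is independent if it has at most
`r` elements. -/
def uniformMatroid (r n : ℕ) : Matroid (Fin n) :=
  (IndepMatroid.ofFinite (E := Set.univ) Set.finite_univ (fun I => I.ncard ≤ r)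
    (by simp)
    (fun I J hJ hIJ => (Set.ncard_le_ncard hIJ).trans hJ)
    (by
      intro I J hI hJ hlt
      obtain ⟨e, heJ, heI⟩ := Set.exists_mem_notMem_of_ncard_lt_ncard hlt
      refine ⟨e, heJ, heI, ?_⟩
      rw [Set.ncard_insert_of_notMem heI]
      omega)
    (fun I _ => Set.subset_univ I)).matroid

theorem uniformMatroid_indep_iff (r n : ℕ) (I : Set (Fin n)) :
    (uniformMatroid r n).Indep I ↔ I.ncard ≤ r := Iff.rfl

/-- The circuits of `U_{r,n}` are the sets with `r + 1` elements. -/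
theorem uniformMatroid_isCircuit_iff (r n : ℕ) (C : Set (Fin n)) :
    (uniformMatroid r n).IsCircuit C ↔ C.ncard = r + 1 := by
  rw [Matroid.isCircuit_iff_forall_ssubset, Matroid.dep_iff, uniformMatroid_indep_iff]
  constructor
  · rintro ⟨⟨h1, -⟩, h2⟩
    have hne : C.Nonempty := by
      rw [← Set.ncard_pos]; omega
    obtain ⟨e, he⟩ := hne
    have h3 : (C \ {e}).ncard ≤ r :=
      h2 (Set.sdiff_singleton_ssubset.2 he)
    have := Set.ncard_sdiff_singleton_add_one he
    omega
  · intro h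
    refine ⟨⟨by omega, Set.subset_univ _⟩, fun I hI => ?_⟩
    have : I.ncard < C.ncard := Set.ncard_lt_ncard hI
    change I.ncard ≤ r
    omega

/-- Every permutation of the ground set is an automorphism of `U_{r,n}`. -/
theorem uniformMatroid_acts (r n : ℕ) :
    ActsByAutomorphisms (uniformMatroid r n) (Equiv.Perm (Fin n)) := by
  intro g C hC
  rw [uniformMatroid_isCircuit_iff] at hC ⊢
  rw [← hC]
  exact Set.ncard_image_of_injective C (MulAction.injective g)

end Uniform

section SymmetricGroup

variable (k : Type u) [Field k] (n : ℕ)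

/-- The `S_n`-module `S^(n-1,1) = {x ∈ k^n : x_1 + ⋯ + x_n = 0}`. -/
def reflectionRep :
    Subrepresentation (Representation.ofMulAction k (Equiv.Perm (Fin n)) (Fin n)) where
  toSubmodule :=
    { carrier := {x | ∑ j, x.coeff j = 0}
      zero_mem' := by simp
      add_mem' := by
        intro x y hx hy
        simp only [Set.mem_ofPred_eq] at hx hy ⊢
        simp [Finset.sum_add_distrib, hx, hy]
      smul_mem' := by
        intro c x hx
        simp only [Set.mem_ofPred_eq] at hx ⊢
        simp [← Finset.mul_sum, hx] }
  apply_mem_toSubmodule g x hx := by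
    change ∑ j, x.coeff j = 0 at hx
    change ∑ j, (Representation.ofMulAction k (Equiv.Perm (Fin n)) (Fin n) g x).coeff j = 0
    simp only [Representation.coeff_ofMulAction]
    rw [← hx]
    exact Equiv.sum_comp g⁻¹ (fun j => x.coeff j)

/-- The class `[S^(n-1,1)]` in `R_k(S_n)`. -/
def reflectionClass : GrothendieckRing k (Equiv.Perm (Fin n)) :=
  subrepClass (reflectionRep k n)

/-- Cut `0, 1, 2, …` into consecutive blocks of the sizes given by the list; this is the index of
the block which contains `j`. -/
def blockIndex : List ℕ → ℕ → ℕ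
  | [], _ => 0
  | a :: l, j => if j < a then 0 else blockIndex l (j - a) + 1

/-- The Young subgroup `S_λ = S_{λ_1} × ⋯ × S_{λ_ℓ}` of `S_n`, for `λ_1 + ⋯ + λ_ℓ = n`: the
permutations which preserve each of the consecutive blocks of sizes `λ_1, …, λ_ℓ`. -/
def youngSubgroup (lam : List ℕ) : Subgroup (Equiv.Perm (Fin n)) where
  carrier := {g | ∀ j : Fin n, blockIndex lam (g j) = blockIndex lam j}
  one_mem' j := rfl
  mul_mem' {g h} hg hh j := (hg (h j)).trans (hh j)
  inv_mem' {g} hg j := by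
    have := hg (g⁻¹ j)
    have h2 : g (g⁻¹ j) = j := g.apply_symm_apply j
    rw [h2] at this
    exact this.symm

/-- The class `φ_λ = [k[S_n / S_λ]]` in `R_k(S_n)`, for `λ_1 + ⋯ + λ_ℓ = n`. -/
def youngClass (lam : List ℕ) : GrothendieckRing k (Equiv.Perm (Fin n)) :=
  permClass k (Equiv.Perm (Fin n)) (Equiv.Perm (Fin n) ⧸ youngSubgroup n lam)

/-- The class `φ_(n-d,1^d)`, which is zero by convention if `d > n`. -/
def hookClass (d : ℕ) : GrothendieckRing k (Equiv.Perm (Fin n)) :=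
  if d ≤ n then youngClass k n ((n - d) :: List.replicate d 1) else 0

end SymmetricGroup

/-- `a_{d,i} = ∑_{j = ⌊d/2⌋}^{i/2} S(2j-1, d-1)`, used for `i` even and `2 ≤ d ≤ i`. -/
def evenCoeff (d i : ℕ) : ℕ :=
  ∑ j ∈ Finset.Icc (d / 2) (i / 2), Nat.stirlingSecond (2 * j - 1) (d - 1)

/-- `b_{d,i} = ∑_{j = ⌊(d-1)/2⌋}^{(i-1)/2} S(2j, d-1)`, used for `i` odd and `2 ≤ d ≤ i`. -/
def oddCoeff (d i : ℕ) : ℕ :=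
  ∑ j ∈ Finset.Icc ((d - 1) / 2) ((i - 1) / 2), Nat.stirlingSecond (2 * j) (d - 1)

end

end RankTwoOS

/-! Let Y = ∑ y_a, the functional with value 1 on every x_a. The annihilator of I₂ consists exactly
of the commutators Y ⊗ z - z ⊗ Y (`hasCentralRelations`), so A^! is T(V^*) with Y made central. A
functional l on V^* with l(Y) = 1 splits V^* as kY plus a copy of V^*/kY and embeds A^! into
T(V^*/kY)[X] with Y ↦ X. Hence multiplication by Y is injective, and there are exact sequences 0 →
A^!_i → A^!_{i+1} → T^{i+1}(V^*/kY) → 0. They are equivariant because Y is invariant; l cannot be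
chosen invariant when the characteristic divides n, which is why the argument uses classes in the
Grothendieck ring and not an equivariant splitting. Since V^* ≅ V as permutation modules and
S^(n-1,1) is the kernel of Y on V, [V^*/kY] = [S^(n-1,1)] = x - 1 with x = φ_(n-1,1). Summing gives
the first formula (`osDualClass_uniformMatroid`).

For the expansion, consecutive powers of x - 1 are paired: (x-1)^m + (x-1)^(m+1) = (x-1)^m x.
Counting injections gives x φ_(n-d,1^d) = φ_(n-d-1,1^(d+1)) + d φ_(n-d,1^d) (`hookClass_one_mul`),
so multiplication by x - 1 follows the Stirling recurrence, and all coefficients are nonnegative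
(`pow_mul_hookClass_one`). -/

namespace RankTwoOS

universe u v

/-! ### Computing with classes in the Grothendieck ring. -/

section GrothendieckRing

variable {k : Type u} [Field k] {G : Type v} [Group G]

theorem toSkeleton_eq_of_linearEquiv {V W : FDRep k G} (e : V ≃ₗ[k] W)
    (he : ∀ g x, e (V.ρ g x) = W.ρ g (e x)) : toSkeleton V = toSkeleton W :=
  Quotient.sound ⟨Action.mkIso (LinearEquiv.toFGModuleCatIso e) fun g => by
    ext x
    exact he g x⟩

variable {U V W : Type u} [AddCommGroup U] [Module k U] [Module.Finite k U]
  [AddCommGroup V] [Module k V] [Module.Finite k V]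
  [AddCommGroup W] [Module k W] [Module.Finite k W]
  {ρU : Representation k G U} {ρV : Representation k G V} {ρW : Representation k G W}

theorem repClass_congr (e : V ≃ₗ[k] W) (he : ∀ g x, e (ρV g x) = ρW g (e x)) :
    repClass ρV = repClass ρW := by
  unfold repClass
  rw [toSkeleton_eq_of_linearEquiv (V := FDRep.of ρV) (W := FDRep.of ρW) e he]

/-- All additive identities below, for disjoint unions of G-sets as well as for the pieces of A^!,
come from this use of the defining relations. -/
theorem repClass_eq_add (f : U →ₗ[k] V) (g : V →ₗ[k] W)
    (hf : ∀ s x, f (ρU s x) = ρV s (f x)) (hg : ∀ s x, g (ρV s x) = ρW s (g x))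
    (injective : Function.Injective f) (exact : Function.Exact f g)
    (surjective : Function.Surjective g) :
    repClass ρV = repClass ρU + repClass ρW := by
  unfold repClass
  rw [← map_add, Ideal.Quotient.eq]
  exact AddSubgroup.subset_closure ⟨FDRep.of ρU, FDRep.of ρV, FDRep.of ρW, f, g,
    ⟨hf, hg, injective, exact, surjective⟩, rfl⟩

theorem repClass_tprod (ρV : Representation k G V) (ρW : Representation k G W) :
    repClass (ρV.tprod ρW) = repClass ρV * repClass ρW := by
  unfold repClass
  rw [← map_mul, ← FreeAbelianGroup.of_mul, ← Skeleton.toSkeleton_tensorObj]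
  rw [toSkeleton_eq_of_linearEquiv (V := FDRep.of (ρV.tprod ρW))
    (W := FDRep.of ρV ⊗ FDRep.of ρW) (LinearEquiv.refl k (V ⊗[k] W)) fun g x => rfl]

theorem repClass_trivial : repClass (Representation.trivial k G k) = 1 := by
  unfold repClass
  rw [← map_one (Ideal.Quotient.mk _), FreeAbelianGroup.one_def, Skeleton.one_eq]
  rw [toSkeleton_eq_of_linearEquiv (V := FDRep.of (Representation.trivial k G k))
    (W := 𝟙_ (FDRep k G)) (LinearEquiv.refl k k) fun g x => rfl]

end GrothendieckRing

/-! ### Classes of permutation representations: sums, products, multiples and orbits. -/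

section Permutation

variable (k : Type u) [Field k] (G : Type v) [Group G]

theorem permClass_congr {X Y : Type} [Finite X] [MulAction G X] [Finite Y] [MulAction G Y]
    (e : X ≃ Y) (he : ∀ (g : G) x, e (g • x) = g • e x) : permClass k G X = permClass k G Y := by
  refine repClass_congr (MonoidAlgebra.mapDomainLinearEquiv k k e) fun g x => ?_
  induction x using MonoidAlgebra.induction_linear with
  | zero => simp
  | add a b ha hb => simp only [map_add, ha, hb]
  | single x r => simp [he]

theorem permClass_sum (X Y : Type) [Finite X] [MulAction G X] [Finite Y] [MulAction G Y] :
    permClass k G (X ⊕ Y) = permClass k G X + permClass k G Y := by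
  let e : MonoidAlgebra k (X ⊕ Y) ≃ₗ[k] MonoidAlgebra k X × MonoidAlgebra k Y :=
    MonoidAlgebra.coeffLinearEquiv k ≪≫ₗ Finsupp.sumFinsuppLEquivProdFinsupp k ≪≫ₗ
      LinearEquiv.prodCongr (MonoidAlgebra.coeffLinearEquiv k).symm
        (MonoidAlgebra.coeffLinearEquiv k).symm
  have e_inl (x : X) (r : k) : e (.single (.inl x) r) = (.single x r, 0) := by
    ext y <;> simp [e]
  have e_inr (y : Y) (r : k) : e (.single (.inr y) r) = (0, .single y r) := by
    ext y <;> simp [e]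
  refine repClass_eq_add (e.symm.toLinearMap ∘ₗ LinearMap.inl k _ _)
    (LinearMap.snd k _ _ ∘ₗ e.toLinearMap) (fun g x => ?_) (fun g x => ?_)
    (e.symm.injective.comp LinearMap.inl_injective) (fun x => ?_)
    (Prod.snd_surjective.comp e.surjective)
  · induction x using MonoidAlgebra.induction_linear with
    | zero => simp only [map_zero]
    | add a b ha hb => simp only [map_add, ha, hb]
    | single x r =>
      have h (x : X) : e.symm (.single x r, 0) = .single (.inl x) r := by
        rw [LinearEquiv.symm_apply_eq, e_inl]
      simp [h]
  · induction x using MonoidAlgebra.induction_linear with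
    | zero => simp
    | add a b ha hb => simp only [map_add, ha, hb]
    | single x r => rcases x with x | x <;> simp [e_inl, e_inr]
  · constructor
    · intro h
      exact ⟨(e x).1, e.injective (Prod.ext (by simp) (by simpa using h.symm))⟩
    · rintro ⟨y, rfl⟩
      simp

theorem permClass_prod (X Y : Type) [Finite X] [MulAction G X] [Finite Y] [MulAction G Y] :
    permClass k G (X × Y) = permClass k G X * permClass k G Y := by
  unfold permClass
  rw [← repClass_tprod]
  symm
  refine repClass_congr (TensorProduct.congr (MonoidAlgebra.coeffLinearEquiv k)
    (MonoidAlgebra.coeffLinearEquiv k) ≪≫ₗ finsuppTensorFinsupp' k X Y ≪≫ₗ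
      (MonoidAlgebra.coeffLinearEquiv k).symm) fun g x => ?_
  induction x with
  | zero => simp
  | add a b ha hb => simp only [map_add, ha, hb]
  | tmul a b =>
    induction a using MonoidAlgebra.induction_linear with
    | zero => simp
    | add a a' ha hb => simp only [TensorProduct.add_tmul, map_add, ha, hb]
    | single x r =>
      induction b using MonoidAlgebra.induction_linear with
      | zero => simp
      | add b b' ha hb => simp only [TensorProduct.tmul_add, map_add, ha, hb]
      | single y s => simp [-Finsupp.single_mul]

theorem permClass_unique (X : Type) [Unique X] [MulAction G X] : permClass k G X = 1 := by
  rw [← repClass_trivial]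
  refine repClass_congr (MonoidAlgebra.coeffLinearEquiv k ≪≫ₗ
    Finsupp.uniqueLinearEquiv k k (default : X)) fun g x => ?_
  have h : Representation.ofMulAction k G X g x = x := by
    refine MonoidAlgebra.coeff_injective (Finsupp.ext fun y => ?_)
    rw [Representation.coeff_ofMulAction, Subsingleton.elim (g⁻¹ • y) y]
  rw [h, Representation.trivial_apply]

/-- An empty set satisfies X ⊕ X ≃ X, so its class c satisfies c + c = c. -/
theorem permClass_isEmpty (X : Type) [IsEmpty X] [MulAction G X] : permClass k G X = 0 := by
  have h := permClass_sum k G X X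
  rwa [permClass_congr k G (Equiv.equivOfIsEmpty (X ⊕ X) X) fun _ x => isEmptyElim x,
    left_eq_add] at h

/-- A set with `d` elements, on which every group acts trivially. -/
def TrivialSet (d : ℕ) : Type := Fin d

instance (d : ℕ) : Finite (TrivialSet d) := inferInstanceAs (Finite (Fin d))

instance (d : ℕ) : MulAction G (TrivialSet d) where
  smul _ x := x
  one_smul _ := rfl
  mul_smul _ _ _ := rfl

/-- With natural numbers realised as G-sets, multiples of permutation classes are again permutation
classes, by taking products. -/
theorem permClass_trivialSet (d : ℕ) : permClass k G (TrivialSet d) = d := by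
  induction d with
  | zero =>
    have : IsEmpty (TrivialSet 0) := inferInstanceAs (IsEmpty (Fin 0))
    rw [permClass_isEmpty, Nat.cast_zero]
  | succ d ih =>
    have : Unique (TrivialSet 1) := inferInstanceAs (Unique (Fin 1))
    rw [Nat.cast_succ, ← ih, ← permClass_unique k G (TrivialSet 1), ← permClass_sum]
    let e : TrivialSet d ⊕ TrivialSet 1 ≃ TrivialSet (d + 1) := finSumFinEquiv
    exact (permClass_congr k G e fun g x => by rcases x with x | x <;> rfl).symm

/-- `x` is the class of a permutation representation. -/
def IsPermClass (x : GrothendieckRing k G) : Prop :=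
  ∃ (X : Type) (_ : Finite X) (_ : MulAction G X), x = permClass k G X

variable {k G}

theorem IsPermClass.natCast (d : ℕ) : IsPermClass k G d :=
  ⟨TrivialSet d, inferInstance, inferInstance, (permClass_trivialSet k G d).symm⟩

theorem IsPermClass.add {x y : GrothendieckRing k G} (hx : IsPermClass k G x)
    (hy : IsPermClass k G y) : IsPermClass k G (x + y) := by
  obtain ⟨X, _, _, rfl⟩ := hx
  obtain ⟨Y, _, _, rfl⟩ := hy
  exact ⟨X ⊕ Y, inferInstance, inferInstance, (permClass_sum k G X Y).symm⟩

theorem IsPermClass.mul {x y : GrothendieckRing k G} (hx : IsPermClass k G x)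
    (hy : IsPermClass k G y) : IsPermClass k G (x * y) := by
  obtain ⟨X, _, _, rfl⟩ := hx
  obtain ⟨Y, _, _, rfl⟩ := hy
  exact ⟨X × Y, inferInstance, inferInstance, (permClass_prod k G X Y).symm⟩

theorem IsPermClass.nsmul {x : GrothendieckRing k G} (hx : IsPermClass k G x) (d : ℕ) :
    IsPermClass k G (d • x) := by
  rw [nsmul_eq_mul]
  exact (IsPermClass.natCast d).mul hx

theorem IsPermClass.sum {ι : Type*} (s : Finset ι) {f : ι → GrothendieckRing k G}
    (hf : ∀ i ∈ s, IsPermClass k G (f i)) : IsPermClass k G (∑ i ∈ s, f i) :=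
  Finset.sum_induction f (IsPermClass k G) (fun _ _ => IsPermClass.add)
    (by simpa using IsPermClass.natCast (k := k) (G := G) 0) hf

end Permutation

/-- Orbit-stabilizer. The subgroup is a variable tied to the stabilizer by `hH`, so that a Young
subgroup can be inserted directly. -/
theorem permClass_quotient (k : Type u) [Field k] {G : Type} [Group G] {X : Type}
    [Finite X] [MulAction G X] [MulAction.IsPretransitive G X] (x : X) {H : Subgroup G}
    [Finite (G ⧸ H)] (hH : H = MulAction.stabilizer G x) :
    permClass k G (G ⧸ H) = permClass k G X := by
  subst hH
  refine permClass_congr k G (Equiv.ofBijective (MulAction.ofQuotientStabilizer G x)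
    ⟨MulAction.injective_ofQuotientStabilizer G x, fun y => ?_⟩)
    (MulAction.ofQuotientStabilizer_smul G x)
  obtain ⟨g, rfl⟩ := MulAction.exists_smul_eq G x y
  exact ⟨g, rfl⟩

/-! ### Hook classes, Stirling numbers and the geometric sum. -/

section SymmetricGroup

variable (k : Type u) [Field k] (n : ℕ)

theorem blockIndex_replicate_one {d j : ℕ} (h : j < d) :
    blockIndex (List.replicate d 1) j = j := by
  induction d generalizing j with
  | zero => omega
  | succ d ih =>
    rw [List.replicate_succ, blockIndex]
    split_ifs with hj
    · omega
    · rw [ih (by omega)]; omega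

variable {n} in
-- The last d blocks are single points and must be fixed; the first block is then preserved
-- automatically.
theorem mem_youngSubgroup_hook {d : ℕ} (hd : d ≤ n) (g : Equiv.Perm (Fin n)) :
    g ∈ youngSubgroup n ((n - d) :: List.replicate d 1) ↔
      ∀ j : Fin n, n - d ≤ (j : ℕ) → g j = j := by
  have key (j : Fin n) : blockIndex ((n - d) :: List.replicate d 1) j =
      if (j : ℕ) < n - d then 0 else j - (n - d) + 1 := by
    rw [blockIndex]
    split_ifs with h
    · rfl
    · rw [blockIndex_replicate_one (by omega)]
  change (∀ j : Fin n, _ = _) ↔ _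
  simp only [key]
  constructor
  · intro h j hj
    specialize h j
    ext
    split_ifs at h <;> omega
  · intro h j
    by_cases hj : n - d ≤ (j : ℕ)
    · rw [h j hj]
    -- If g j lay among the last d points, it would be fixed by g, and injectivity would force g j =
    -- j.
    · have : ¬ n - d ≤ (g j : ℕ) := fun hg => hj (by rwa [g.injective (h _ hg)] at hg)
      rw [if_pos (by omega), if_pos (by omega)]

/-- `φ_(n-d,1^d)` is the class of the permutation representation on injections `[d] → [n]`. -/
theorem hookClass_eq (d : ℕ) :
    hookClass k n d = permClass k (Equiv.Perm (Fin n)) (Fin d ↪ Fin n) := by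
  unfold hookClass
  split_ifs with hd
  -- The injection onto the last d points, where the blocks of size one lie; its stabilizer is the
  -- Young subgroup.
  · let f : Fin d ↪ Fin n :=
      ⟨fun j => ⟨n - d + j, by omega⟩, fun a b h => by
        have := congrArg Fin.val h
        ext
        simpa using this⟩
    have hs : MulAction.stabilizer (Equiv.Perm (Fin n)) f =
        youngSubgroup n ((n - d) :: List.replicate d 1) := by
      ext g
      rw [mem_youngSubgroup_hook hd, MulAction.mem_stabilizer_iff, DFunLike.ext_iff]
      constructor
      · intro h j hj
        have hf : f ⟨j - (n - d), by omega⟩ = j := by ext; exact Nat.add_sub_cancel' hj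
        rw [← hf]
        exact h _
      · intro h j
        exact h (f j) (Nat.le_add_right _ _)
    have : MulAction.IsPretransitive (Equiv.Perm (Fin n)) (Fin d ↪ Fin n) :=
      ⟨Equiv.Perm.exists_smul_eq_embedding⟩
    unfold youngClass
    exact permClass_quotient k f hs.symm
  -- For d > n there are no injections, in agreement with the convention φ = 0.
  · have : IsEmpty (Fin d ↪ Fin n) := ⟨fun f => hd (by simpa using Fintype.card_le_of_embedding f)⟩
    rw [permClass_isEmpty]

theorem isPermClass_hookClass (d : ℕ) : IsPermClass k _ (hookClass k n d) :=
  ⟨_, inferInstance, inferInstance, hookClass_eq k n d⟩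

theorem hookClass_zero : hookClass k n 0 = 1 := by
  rw [hookClass_eq, permClass_unique]

theorem hookClass_one : hookClass k n 1 = permClass k (Equiv.Perm (Fin n)) (Fin n) := by
  rw [hookClass_eq]
  exact permClass_congr k _ (Equiv.uniqueEmbeddingEquivResult (α := Fin 1)) fun g x => rfl

/-- A pair of an element `a` and an injection `f : [d] → [n]` either extends `f` to an injection
`[d + 1] → [n]`, or is given by the index `j` with `f j = a`. -/
theorem hookClass_one_mul (d : ℕ) :
    hookClass k n 1 * hookClass k n d = hookClass k n (d + 1) + d * hookClass k n d := by
  rw [hookClass_one, hookClass_eq, hookClass_eq, ← permClass_trivialSet k (Equiv.Perm (Fin n)) d,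
    ← permClass_prod, ← permClass_prod, ← permClass_sum]
  let F : (Fin (d + 1) ↪ Fin n) ⊕ TrivialSet d × (Fin d ↪ Fin n) → Fin n × (Fin d ↪ Fin n) :=
    Sum.elim (fun f => (f (Fin.last d), Fin.castSuccEmb.trans f))
      (fun p => (p.2 p.1, p.2))
  have hF : Function.Bijective F := by
    constructor
    · rintro (f | ⟨i, f⟩) (g | ⟨j, g⟩) h
      · have h1 : f (Fin.last d) = g (Fin.last d) := congrArg Prod.fst h
        have h2 : Fin.castSuccEmb.trans f = Fin.castSuccEmb.trans g := congrArg Prod.snd h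
        congr 1
        ext i
        induction i using Fin.lastCases with
        | last => exact congrArg Fin.val h1
        | cast i => exact congrArg Fin.val (DFunLike.congr_fun h2 i)
      · have h1 : f (Fin.last d) = g j := congrArg Prod.fst h
        have h2 : Fin.castSuccEmb.trans f = g := congrArg Prod.snd h
        subst h2
        exact absurd (f.injective h1) (Fin.castSucc_lt_last j).ne'
      · have h1 : f i = g (Fin.last d) := congrArg Prod.fst h
        have h2 : f = Fin.castSuccEmb.trans g := congrArg Prod.snd h
        subst h2
        exact absurd (g.injective h1) (Fin.castSucc_lt_last i).ne
      · have h1 : f i = g j := congrArg Prod.fst h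
        have h2 : f = g := congrArg Prod.snd h
        subst h2
        rw [f.injective h1]
    · rintro ⟨a, f⟩
      by_cases ha : a ∈ Set.range f
      · obtain ⟨i, rfl⟩ := ha
        exact ⟨.inr (i, f), rfl⟩
      · refine ⟨.inl ⟨Fin.snoc f a, Fin.snoc_injective_iff.2 ⟨f.injective, ha⟩⟩, ?_⟩
        refine Prod.ext (by simp [F]) ?_
        ext i
        simp [F]
  refine (permClass_congr k _ (Equiv.ofBijective F hF) fun g x => ?_).symm
  rcases x with f | ⟨i, f⟩ <;> rfl

/-- The class `x = φ_(n-1,1) - 1` satisfies `x φ_(n-d,1^d) = φ_(n-d-1,1^(d+1)) + (d-1)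
φ_(n-d,1^d)`, so the Stirling numbers give the expansion of `x^m φ_(n-1,1)`. -/
theorem pow_mul_hookClass_one {m N : ℕ} (hN : m < N) :
    (hookClass k n 1 - 1) ^ m * hookClass k n 1 =
      ∑ d ∈ Finset.range N, m.stirlingSecond d • hookClass k n (d + 1) := by
  induction m generalizing N with
  | zero =>
    obtain ⟨N, rfl⟩ := Nat.exists_eq_add_of_lt hN
    rw [zero_add, Finset.sum_range_succ']
    simp
  | succ m ih =>
    obtain ⟨N, rfl⟩ : ∃ M, N = M + 1 := ⟨N - 1, by omega⟩
    have key (d : ℕ) : (hookClass k n 1 - 1) * hookClass k n (d + 1) =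
        hookClass k n (d + 2) + d • hookClass k n (d + 1) := by
      rw [sub_mul, hookClass_one_mul, nsmul_eq_mul]
      push_cast
      ring
    -- Index shift for ∑ d S(m,d) φ_(n-d-1,1^(d+1)): the bottom term has the factor d = 0, and the
    -- top term vanishes because S(m,N) = 0 for m < N.
    have shift := Finset.sum_range_succ
      (fun d => (d * m.stirlingSecond d) • hookClass k n (d + 1)) N
    rw [Finset.sum_range_succ', Nat.stirlingSecond_eq_zero_of_lt (n := m) (k := N) (by omega)]
      at shift
    simp only [zero_mul, mul_zero, zero_smul, add_zero] at shift
    rw [pow_succ', mul_assoc, ih (N := N) (by omega), Finset.mul_sum, Finset.sum_range_succ' _ N]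
    simp only [mul_smul_comm, key, smul_add, smul_smul, Nat.stirlingSecond_succ_zero,
      Nat.stirlingSecond_succ_succ, add_smul, Finset.sum_add_distrib, zero_smul, add_zero, shift]
    rw [add_comm]
    congr 1
    exact Finset.sum_congr rfl fun x _ => by rw [mul_comm]
theorem youngClass_singleton : youngClass k n [n] = 1 := by
  rw [← hookClass_zero k n, hookClass, if_pos (Nat.zero_le n), Nat.sub_zero, List.replicate_zero]

theorem youngClass_pair (hn : 1 ≤ n) : youngClass k n [n - 1, 1] = hookClass k n 1 := by
  rw [hookClass, if_pos hn, List.replicate_one]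

theorem sum_range_eq_add_sum_Icc_two {M : Type*} [AddCommMonoid M] (i : ℕ) (f : ℕ → M) :
    ∑ d ∈ Finset.range (i + 1), f (d + 1) = f 1 + ∑ d ∈ Finset.Icc 2 (i + 1), f d := by
  induction i with
  | zero => simp
  | succ i ih =>
    rw [Finset.sum_range_succ, ih, Finset.sum_Icc_succ_top (b := i + 1) (by omega), add_assoc]

/-- The lower summation bound can be moved down to 1, since S(2j-1, d-1) = 0 for j < ⌊d/2⌋. The
result is a range independent of d, as needed to interchange sums. -/
theorem evenCoeff_eq {d i : ℕ} (hd : 2 ≤ d) :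
    evenCoeff d i = ∑ j ∈ Finset.range (i / 2), (2 * j + 1).stirlingSecond (d - 1) := by
  have h : ∑ j ∈ Finset.range (i / 2), (2 * j + 1).stirlingSecond (d - 1) =
      ∑ j ∈ Finset.Icc 1 (i / 2), (2 * j - 1).stirlingSecond (d - 1) := by
    rw [← Finset.Ico_succ_right_eq_Icc, Finset.sum_Ico_eq_sum_range]
    refine Finset.sum_congr (by simp) fun j _ => ?_
    congr 1
    omega
  rw [h, evenCoeff]
  refine Finset.sum_subset (Finset.Icc_subset_Icc_left (by omega)) fun j hj hj' => ?_
  rw [Finset.mem_Icc] at hj hj'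
  exact Nat.stirlingSecond_eq_zero_of_lt (by omega)

theorem oddCoeff_eq (d i : ℕ) :
    oddCoeff d i = ∑ j ∈ Finset.range ((i - 1) / 2 + 1), (2 * j).stirlingSecond (d - 1) := by
  refine Finset.sum_subset (fun j hj => ?_) fun j hj hj' => ?_
  · rw [Finset.mem_Icc] at hj
    exact Finset.mem_range.2 (by omega)
  · rw [Finset.mem_range] at hj
    rw [Finset.mem_Icc] at hj'
    exact Nat.stirlingSecond_eq_zero_of_lt (by omega)

/-- Exponents 2j+1 and 2j+2 are paired; exponent 0 is left over. -/
theorem geom_sum_eq_of_even {R : Type*} [CommRing R] (x : R) (m : ℕ) :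
    ∑ j ∈ Finset.range (2 * m + 1), (x - 1) ^ j =
      1 + ∑ j ∈ Finset.range m, (x - 1) ^ (2 * j + 1) * x := by
  induction m with
  | zero => simp
  | succ m ih =>
    rw [mul_add, mul_one, Finset.sum_range_succ, Finset.sum_range_succ, ih,
      Finset.sum_range_succ _ m]
    ring

/-- Exponents 2j and 2j+1 are paired, and nothing is left over. -/
theorem geom_sum_eq_of_odd {R : Type*} [CommRing R] (x : R) (m : ℕ) :
    ∑ j ∈ Finset.range (2 * m + 2), (x - 1) ^ j =
      ∑ j ∈ Finset.range (m + 1), (x - 1) ^ (2 * j) * x := by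
  induction m with
  | zero => simp [Finset.sum_range_succ]
  | succ m ih =>
    rw [mul_add, mul_one, Finset.sum_range_succ, Finset.sum_range_succ, ih,
      Finset.sum_range_succ _ (m + 1)]
    ring

theorem geom_sum_hookClass_of_even {i : ℕ} (hi : Even i) :
    ∑ j ∈ Finset.range (i + 1), (hookClass k n 1 - 1) ^ j =
      youngClass k n [n] + ∑ d ∈ Finset.Icc 2 i, evenCoeff d i • hookClass k n d := by
  obtain ⟨m, rfl⟩ := hi.two_dvd
  rw [geom_sum_eq_of_even, youngClass_singleton]
  congr 1
  rcases Nat.eq_zero_or_pos m with rfl | hm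
  · simp
  -- One length N = 2m exceeds all the exponents 2j+1, so the two sums can be interchanged.
  have h (j) (hj : j ∈ Finset.range m) := pow_mul_hookClass_one k n (m := 2 * j + 1) (N := 2 * m)
    (by rw [Finset.mem_range] at hj; omega)
  rw [Finset.sum_congr rfl h, Finset.sum_comm]
  obtain ⟨l, hl⟩ : ∃ l, 2 * m = l + 1 := ⟨2 * m - 1, by omega⟩
  have := sum_range_eq_add_sum_Icc_two l fun d =>
    ∑ j ∈ Finset.range m, (2 * j + 1).stirlingSecond (d - 1) • hookClass k n d
  simp only [Nat.add_sub_cancel, ← hl] at this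
  rw [this]
  -- The term d = 1 has the coefficients S(2j+1, 0) = 0.
  simp only [Nat.sub_self, Nat.stirlingSecond_succ_zero, zero_smul, Finset.sum_const_zero, zero_add]
  refine Finset.sum_congr rfl fun d hd => ?_
  rw [evenCoeff_eq (Finset.mem_Icc.1 hd).1, Finset.sum_smul, Nat.mul_div_cancel_left m two_pos]

theorem geom_sum_hookClass_of_odd (hn : 1 ≤ n) {i : ℕ} (hi : Odd i) :
    ∑ j ∈ Finset.range (i + 1), (hookClass k n 1 - 1) ^ j =
      youngClass k n [n - 1, 1] + ∑ d ∈ Finset.Icc 2 i, oddCoeff d i • hookClass k n d := by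
  obtain ⟨m, rfl⟩ := hi
  have h (j) (hj : j ∈ Finset.range (m + 1)) := pow_mul_hookClass_one k n (m := 2 * j)
    (N := 2 * m + 1) (by rw [Finset.mem_range] at hj; omega)
  have := sum_range_eq_add_sum_Icc_two (2 * m) fun d =>
    ∑ j ∈ Finset.range (m + 1), (2 * j).stirlingSecond (d - 1) • hookClass k n d
  simp only [Nat.add_sub_cancel] at this
  rw [geom_sum_eq_of_odd, youngClass_pair k n hn, Finset.sum_congr rfl h, Finset.sum_comm, this]
  congr 1
  -- In the term d = 1, S(2j, 0) is nonzero only for j = 0, so φ_(n-1,1) occurs exactly once.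
  · simp [Finset.sum_range_succ', mul_add]
  · refine Finset.sum_congr rfl fun d hd => ?_
    rw [oddCoeff_eq, Finset.sum_smul, Nat.add_sub_cancel, Nat.mul_div_cancel_left m two_pos]

theorem stirlingSecond_succ_succ_pos {m d : ℕ} (h : d ≤ m) :
    0 < (m + 1).stirlingSecond (d + 1) := by
  induction m generalizing d with
  | zero =>
    obtain rfl : d = 0 := by omega
    exact Nat.one_pos
  | succ m ih =>
    cases d with
    | zero => simp [Nat.stirlingSecond_one_right]
    | succ d =>
      rw [Nat.stirlingSecond_succ_succ]
      exact Nat.add_pos_right _ (ih (by omega))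

/-- The top summand S(i-1, d-1) is already positive, because 1 ≤ d-1 ≤ i-1. The same summand serves
for odd i. -/
theorem evenCoeff_pos {d i : ℕ} (hd : d ∈ Finset.Icc 2 i) (hi : Even i) : 0 < evenCoeff d i := by
  rw [Finset.mem_Icc] at hd
  obtain ⟨m, rfl⟩ := hi.two_dvd
  refine Finset.sum_pos' (fun _ _ => Nat.zero_le _) ⟨m, Finset.mem_Icc.2 (by omega), ?_⟩
  obtain ⟨a, ha⟩ : ∃ a, 2 * m - 1 = a + 1 := ⟨2 * m - 2, by omega⟩
  obtain ⟨b, hb⟩ : ∃ b, d - 1 = b + 1 := ⟨d - 2, by omega⟩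
  rw [ha, hb]
  exact stirlingSecond_succ_succ_pos (by omega)

theorem oddCoeff_pos {d i : ℕ} (hd : d ∈ Finset.Icc 2 i) (hi : Odd i) : 0 < oddCoeff d i := by
  rw [Finset.mem_Icc] at hd
  obtain ⟨m, rfl⟩ := hi
  refine Finset.sum_pos' (fun _ _ => Nat.zero_le _) ⟨m, Finset.mem_Icc.2 (by omega), ?_⟩
  obtain ⟨a, ha⟩ : ∃ a, 2 * m = a + 1 := ⟨2 * m - 1, by omega⟩
  obtain ⟨b, hb⟩ : ∃ b, d - 1 = b + 1 := ⟨d - 2, by omega⟩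
  rw [ha, hb]
  exact stirlingSecond_succ_succ_pos (by omega)

end SymmetricGroup

/-! ### Tensor powers as the graded pieces of the tensor algebra, with group action. -/

section TensorPower

open PiTensorProduct

variable {k : Type u} [Field k] {W : Type u} [AddCommGroup W] [Module k W]

theorem ofDirectSum_of {i : ℕ} (x : ⨂[k]^i W) :
    TensorAlgebra.ofDirectSum (DirectSum.of (fun n => ⨂[k]^n W) i x) =
      TensorPower.toTensorAlgebra x :=
  DirectSum.toAddMonoid_of (fun _ => LinearMap.toAddMonoidHom TensorPower.toTensorAlgebra) _ _

/-- The component of degree `i` of an element of the tensor algebra. -/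
noncomputable def tensorComponent (k : Type u) [Field k] (W : Type u) [AddCommGroup W] [Module k W]
    (i : ℕ) : TensorAlgebra k W →ₗ[k] ⨂[k]^i W :=
  DirectSum.component k ℕ (fun n => ⨂[k]^n W) i ∘ₗ TensorAlgebra.toDirectSum.toLinearMap

/-- This left inverse lets elements of a tensor power be computed inside the tensor algebra, where
maps are determined by generators. -/
theorem tensorComponent_toTensorAlgebra {i : ℕ} (x : ⨂[k]^i W) :
    tensorComponent k W i (TensorPower.toTensorAlgebra x) = x := by
  rw [← ofDirectSum_of]
  simp only [tensorComponent, LinearMap.comp_apply, AlgHom.toLinearMap_apply,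
    TensorAlgebra.toDirectSum_ofDirectSum]
  exact DirectSum.component.lof_self (R := k) (M := fun n => ⨂[k]^n W) i x

theorem toTensorAlgebra_mul_ι {i : ℕ} (x : ⨂[k]^i W) (w : W) :
    TensorPower.toTensorAlgebra x * TensorAlgebra.ι k w =
      TensorPower.toTensorAlgebra (TensorPower.mulEquiv (x ⊗ₜ tprod k fun _ : Fin 1 => w)) := by
  have h := TensorPower.toTensorAlgebra_gMul x (tprod k fun _ : Fin 1 => w)
  rw [TensorPower.toTensorAlgebra_tprod] at h
  rw [TensorPower.gMul_def] at h
  rw [h, TensorAlgebra.tprod_apply]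
  simp

variable {G : Type v} [Group G] (σ : Representation k G W)

/-- The `i`-th tensor power of a representation. -/
noncomputable def tensorPowerRep (i : ℕ) : Representation k G (⨂[k]^i W) where
  toFun g := PiTensorProduct.map fun _ => σ g
  map_one' := by
    simp only [map_one]
    exact PiTensorProduct.map_one
  map_mul' g h := by
    simp only [map_mul]
    exact PiTensorProduct.map_mul _ _

theorem tensorPowerRep_tprod (i : ℕ) (g : G) (w : Fin i → W) :
    tensorPowerRep σ i g (tprod k w) = tprod k fun j => σ g (w j) :=
  PiTensorProduct.map_tprod _ _

theorem toTensorAlgebra_tensorPowerRep (i : ℕ) (g : G) (x : ⨂[k]^i W) :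
    TensorPower.toTensorAlgebra (tensorPowerRep σ i g x) =
      TensorAlgebra.lift k (TensorAlgebra.ι k ∘ₗ σ g) (TensorPower.toTensorAlgebra x) := by
  induction x using PiTensorProduct.induction_on with
  | smul_tprod r w =>
    simp only [map_smul, tensorPowerRep_tprod, TensorPower.toTensorAlgebra_tprod,
      TensorAlgebra.tprod_apply, map_list_prod, List.map_ofFn]
    simp [Function.comp_def]
  | add x y hx hy => simp only [map_add, hx, hy]

/-- Induction through the equivariant isomorphism T^i(W) ⊗ W ≅ T^(i+1)(W). -/
theorem repClass_tensorPowerRep [Module.Finite k W] (i : ℕ) :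
    repClass (tensorPowerRep σ i) = repClass σ ^ i := by
  induction i with
  | zero =>
    rw [pow_zero, ← repClass_trivial]
    refine repClass_congr (PiTensorProduct.isEmptyEquiv (Fin 0)) fun g x => ?_
    induction x using PiTensorProduct.induction_on with
    | smul_tprod r w =>
      rw [map_smul, map_smul, tensorPowerRep_tprod, map_smul, map_smul]
      simp
    | add x y hx hy => simp only [map_add, hx, hy]
  | succ i ih =>
    rw [pow_succ, ← ih, ← repClass_tprod]
    symm
    refine repClass_congr (LinearEquiv.lTensor _
      (PiTensorProduct.subsingletonEquiv (R := k) (s := fun _ => W) (0 : Fin 1)).symm ≪≫ₗ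
        TensorPower.mulEquiv) fun g x => ?_
    induction x with
    | zero => simp
    | add x y hx hy => simp only [map_add, hx, hy]
    | tmul x w =>
      induction x using PiTensorProduct.induction_on with
      | add x y hx hy => simp only [TensorProduct.add_tmul, map_add, hx, hy]
      | smul_tprod r x =>
        rw [← TensorProduct.smul_tmul', map_smul, map_smul, map_smul, map_smul]
        congr 1
        have hw (w : W) : (PiTensorProduct.subsingletonEquiv (R := k) (s := fun _ => W)
            (0 : Fin 1)).symm w = tprod k fun _ => w :=
          PiTensorProduct.subsingletonEquiv_symm_apply' _ _
        have hmul (x : Fin i → W) (w : W) : TensorPower.mulEquiv ((tprod k x) ⊗ₜ[k]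
            (tprod k fun _ : Fin 1 => w)) = tprod k (Fin.append x fun _ => w) :=
          TensorPower.tprod_mul_tprod k x fun _ => w
        simp only [Representation.tprod_apply, TensorProduct.map_tmul, tensorPowerRep_tprod,
          LinearEquiv.trans_apply, LinearEquiv.lTensor_tmul, hw, hmul]
        congr 1
        ext j
        refine Fin.addCases (fun j => ?_) (fun j => ?_) j
        · simp
        · simp

end TensorPower

/-! ### Structure of A^! when its relations say that Y is central. -/

section CentralElement

open Polynomial

variable {k : Type u} [Field k] {V : Type u} [AddCommGroup V] [Module k V]
  (I₂ : Submodule k (V ⊗[k] V)) (Y : Module.Dual k V)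

/-- The relations of the quadratic dual are `Y ⊗ z - z ⊗ Y = 0`, that is, `A^!` is the largest
quotient of `T(V^*)` in which `Y` is central. -/
def HasCentralRelations : Prop :=
  ∀ p : Module.Dual k V ⊗[k] Module.Dual k V,
    (∀ q ∈ I₂, TensorProduct.dualDistrib k V V p q = 0) ↔ ∃ z, p = Y ⊗ₜ z - z ⊗ₜ Y

/-- The quotient `V^* / k Y`. -/
def DualQuotient : Type u := Module.Dual k V ⧸ Submodule.span k {Y}

noncomputable instance : AddCommGroup (DualQuotient Y) :=
  inferInstanceAs (AddCommGroup (Module.Dual k V ⧸ Submodule.span k {Y}))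

noncomputable instance : Module k (DualQuotient Y) :=
  inferInstanceAs (Module k (Module.Dual k V ⧸ Submodule.span k {Y}))

instance [Module.Finite k V] : Module.Finite k (DualQuotient Y) :=
  inferInstanceAs (Module.Finite k (Module.Dual k V ⧸ Submodule.span k {Y}))

/-- The projection `V^* → V^* / k Y`. -/
noncomputable def dualMk : Module.Dual k V →ₗ[k] DualQuotient Y := (Submodule.span k {Y}).mkQ

theorem dualMk_surjective : Function.Surjective (dualMk Y) := Submodule.mkQ_surjective _

theorem dualMk_eq_zero {z : Module.Dual k V} : dualMk Y z = 0 ↔ z ∈ Submodule.span k {Y} :=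
  Submodule.Quotient.mk_eq_zero _

theorem dualMk_self : dualMk Y Y = 0 :=
  (dualMk_eq_zero Y).2 (Submodule.mem_span_singleton_self Y)

variable {I₂} {Y}

theorem degreeTwo_tmul (y z : Module.Dual k V) :
    degreeTwo k (Module.Dual k V) (y ⊗ₜ z) = TensorAlgebra.ι k y * TensorAlgebra.ι k z := rfl

/-- A linear map from `V^*` to an algebra extends to `A^!` if the image of `Y` commutes with the
image of `V^*`. -/
noncomputable def centralLift (h : HasCentralRelations I₂ Y) {B : Type*} [Ring B] [Algebra k B]
    (f : Module.Dual k V →ₗ[k] B) (hf : ∀ z, Commute (f Y) (f z)) :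
    QuadraticDual I₂ →ₐ[k] B :=
  RingQuot.liftAlgHom k ⟨TensorAlgebra.lift k f, by
    rintro _ _ ⟨p, hp⟩
    obtain ⟨z, rfl⟩ := (h p).1 hp
    simp only [map_sub, degreeTwo_tmul, map_mul, TensorAlgebra.lift_ι_apply, map_zero]
    rw [(hf z).eq, sub_self]⟩

theorem centralLift_mk (h : HasCentralRelations I₂ Y) {B : Type*} [Ring B] [Algebra k B]
    (f : Module.Dual k V →ₗ[k] B) (hf : ∀ z, Commute (f Y) (f z))
    (t : TensorAlgebra k (Module.Dual k V)) :
    centralLift h f hf (quadraticDualMk I₂ t) = TensorAlgebra.lift k f t :=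
  RingQuot.liftAlgHom_mkAlgHom_apply _ _ _ _

variable (I₂) in
/-- The generators of `A^!`. -/
noncomputable def quadraticDualι : Module.Dual k V →ₗ[k] QuadraticDual I₂ :=
  (quadraticDualMk I₂).toLinearMap ∘ₗ TensorAlgebra.ι k

theorem centralLift_ι (h : HasCentralRelations I₂ Y) {B : Type*} [Ring B] [Algebra k B]
    (f : Module.Dual k V →ₗ[k] B) (hf : ∀ z, Commute (f Y) (f z)) (z : Module.Dual k V) :
    centralLift h f hf (quadraticDualι I₂ z) = f z :=
  (centralLift_mk h f hf _).trans (TensorAlgebra.lift_ι_apply _ _)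

theorem quadraticDual_algHom_ext {B : Type*} [Semiring B] [Algebra k B]
    {f g : QuadraticDual I₂ →ₐ[k] B}
    (h : ∀ z, f (quadraticDualι I₂ z) = g (quadraticDualι I₂ z)) : f = g :=
  RingQuot.ringQuot_ext' k _ _ (TensorAlgebra.hom_ext (LinearMap.ext h))

theorem quadraticDualPiece_eq (i : ℕ) :
    quadraticDualPiece I₂ i = LinearMap.range (quadraticDualι I₂) ^ i := by
  rw [quadraticDualPiece, Submodule.map_pow, quadraticDualι, LinearMap.range_comp]

theorem commute_quadraticDualι (h : HasCentralRelations I₂ Y) (a : QuadraticDual I₂) :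
    Commute a (quadraticDualι I₂ Y) := by
  obtain ⟨t, rfl⟩ := RingQuot.mkAlgHom_surjective k (QuadraticDualRel I₂) a
  change Commute (quadraticDualMk I₂ t) _
  induction t using TensorAlgebra.induction with
  | algebraMap r =>
    rw [AlgHom.commutes]
    exact Algebra.commute_algebraMap_left _ _
  | ι z =>
    have := RingQuot.mkAlgHom_rel k (QuadraticDualRel.of (I₂ := I₂) _ ((h _).2 ⟨z, rfl⟩))
    rw [map_zero, map_sub, map_sub, sub_eq_zero, degreeTwo_tmul, degreeTwo_tmul, map_mul,
      map_mul] at this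
    exact this.symm
  | mul a b ha hb => rw [map_mul]; exact ha.mul_left hb
  | add a b ha hb => rw [map_add]; exact ha.add_left hb

/-- The projection `A^! → A^! / (Y) = T(V^* / k Y)`. -/
noncomputable def dualProjection (h : HasCentralRelations I₂ Y) :
    QuadraticDual I₂ →ₐ[k] TensorAlgebra k (DualQuotient Y) :=
  centralLift h (TensorAlgebra.ι k ∘ₗ dualMk Y) fun z => by
    rw [LinearMap.comp_apply, dualMk_self, map_zero]
    exact Commute.zero_left _

theorem dualProjection_ι (h : HasCentralRelations I₂ Y) (z : Module.Dual k V) :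
    dualProjection h (quadraticDualι I₂ z) =
      TensorAlgebra.ι k (dualMk Y z) :=
  centralLift_ι _ _ _ _

theorem dualProjection_ι_self (h : HasCentralRelations I₂ Y) :
    dualProjection h (quadraticDualι I₂ Y) = 0 := by
  rw [dualProjection_ι, dualMk_self, map_zero]

variable {l : Module.Dual k V →ₗ[k] k}

/-- The section `z ↦ z - l(z) Y` of the projection `V^* → V^* / k Y`, for `l` with `l(Y) = 1`. -/
noncomputable def dualSection (hl : l Y = 1) : DualQuotient Y →ₗ[k] Module.Dual k V :=
  (Submodule.span k {Y}).liftQ (LinearMap.id - l.smulRight Y) (by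
    rw [Submodule.span_singleton_le_iff_mem, LinearMap.mem_ker]
    simp [hl])

theorem dualSection_dualMk (hl : l Y = 1) (z : Module.Dual k V) :
    dualSection hl (dualMk Y z) = z - l z • Y := rfl

variable (I₂) in
/-- The section `T(V^* / k Y) → A^!` of the projection. -/
noncomputable def algSection (hl : l Y = 1) :
    TensorAlgebra k (DualQuotient Y) →ₐ[k] QuadraticDual I₂ :=
  TensorAlgebra.lift k (quadraticDualι I₂ ∘ₗ dualSection hl)

theorem algSection_ι (hl : l Y = 1) (w : DualQuotient Y) :
    algSection I₂ hl (TensorAlgebra.ι k w) = quadraticDualι I₂ (dualSection hl w) :=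
  TensorAlgebra.lift_ι_apply _ _

theorem dualProjection_algSection (h : HasCentralRelations I₂ Y) (hl : l Y = 1)
    (t : TensorAlgebra k (DualQuotient Y)) :
    dualProjection h (algSection I₂ hl t) = t := by
  have : (dualProjection h).comp (algSection I₂ hl) = AlgHom.id k _ := by
    refine TensorAlgebra.hom_ext (LinearMap.ext fun w => ?_)
    obtain ⟨z, rfl⟩ := dualMk_surjective Y w
    simp only [LinearMap.comp_apply, AlgHom.toLinearMap_apply, AlgHom.comp_apply, algSection_ι,
      dualSection_dualMk, map_sub, map_smul, dualProjection_ι_self, smul_zero, sub_zero,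
      dualProjection_ι, AlgHom.id_apply]
  exact AlgHom.congr_fun this t

/-- The map `A^! → T(V^* / k Y)[X]`, `z ↦ z + l(z) X`, which is an isomorphism. -/
noncomputable def toPolynomial (h : HasCentralRelations I₂ Y) (l : Module.Dual k V →ₗ[k] k) :
    QuadraticDual I₂ →ₐ[k] (TensorAlgebra k (DualQuotient Y))[X] :=
  centralLift h (CAlgHom.toLinearMap ∘ₗ TensorAlgebra.ι k ∘ₗ dualMk Y +
    l.smulRight X) fun z => by
      rw [LinearMap.add_apply, LinearMap.comp_apply, LinearMap.comp_apply, dualMk_self, map_zero, map_zero,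
        zero_add]
      exact (Polynomial.commute_X _).smul_left _

theorem toPolynomial_ι (h : HasCentralRelations I₂ Y) (z : Module.Dual k V) :
    toPolynomial h l (quadraticDualι I₂ z) =
      C (TensorAlgebra.ι k (dualMk Y z)) + l z • X :=
  centralLift_ι _ _ _ _

/-- A left inverse sends X to Y and is `algSection` on coefficients; it is a well-defined algebra
map because Y is central. -/
theorem toPolynomial_injective (h : HasCentralRelations I₂ Y) (hl : l Y = 1) :
    Function.Injective (toPolynomial h l) := by
  let Ψ : (TensorAlgebra k (DualQuotient Y))[X] →ₐ[k] QuadraticDual I₂ :=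
    eval₂AlgHom (algSection I₂ hl) (quadraticDualι I₂ Y) fun a => commute_quadraticDualι h _
  have hC (t) : Ψ (C t) = algSection I₂ hl t := eval₂_C _ _
  have hX : Ψ X = quadraticDualι I₂ Y := eval₂_X _ _
  have : Ψ.comp (toPolynomial h l) = AlgHom.id k _ := by
    refine quadraticDual_algHom_ext fun z => ?_
    rw [AlgHom.comp_apply, toPolynomial_ι, map_add, map_smul, hC, hX, algSection_ι,
      dualSection_dualMk, map_sub, map_smul, sub_add_cancel, AlgHom.id_apply]
  exact Function.LeftInverse.injective (AlgHom.congr_fun this)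

/-- Multiplication by `Y` is injective on `A^!`. -/
theorem quadraticDualι_mul_injective (h : HasCentralRelations I₂ Y) (hl : l Y = 1) :
    Function.Injective fun a => quadraticDualι I₂ Y * a := by
  intro a b hab
  apply toPolynomial_injective h hl
  have := congrArg (toPolynomial h l) hab
  simp only [map_mul, toPolynomial_ι, dualMk_self, map_zero, zero_add, hl, one_smul] at this
  -- Since l(Y) = 1, Y is sent to X, which is regular in a polynomial ring even over noncommutative
  -- coefficients.
  exact isRegular_X.left this

theorem exists_eq_algSection (hl : l Y = 1) {t : QuadraticDual I₂}
    (ht : t ∈ quadraticDualPiece I₂ 0) :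
    ∃ x : ⨂[k]^0 (DualQuotient Y), t = algSection I₂ hl (TensorPower.toTensorAlgebra x) := by
  rw [quadraticDualPiece_eq, pow_zero, Submodule.mem_one] at ht
  obtain ⟨r, rfl⟩ := ht
  refine ⟨DirectSum.GAlgebra.toFun (A := fun n => ⨂[k]^n (DualQuotient Y)) r, ?_⟩
  rw [TensorPower.toTensorAlgebra_galgebra_toFun, AlgHom.commutes]

theorem algSection_ι_mem (hl : l Y = 1) (w : DualQuotient Y) :
    algSection I₂ hl (TensorAlgebra.ι k w) ∈ LinearMap.range (quadraticDualι I₂) :=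
  ⟨_, (algSection_ι hl w).symm⟩

theorem quadraticDualι_eq (hl : l Y = 1) (z : Module.Dual k V) :
    quadraticDualι I₂ z = l z • quadraticDualι I₂ Y +
      algSection I₂ hl (TensorAlgebra.ι k (dualMk Y z)) := by
  rw [algSection_ι, dualSection_dualMk, map_sub, map_smul, add_sub_cancel]

/-- This gives exactness in the middle: the projection kills the first summand and recovers x from
the second, so its kernel in degree i+1 is Y A^!_i. The proof is by recursion on the degree, peeling
off the last factor of a product. -/
theorem exists_eq_mul_add_algSection (h : HasCentralRelations I₂ Y) (hl : l Y = 1) {i : ℕ}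
    {t : QuadraticDual I₂} (ht : t ∈ quadraticDualPiece I₂ (i + 1)) :
    ∃ u ∈ quadraticDualPiece I₂ i, ∃ x : ⨂[k]^(i + 1) (DualQuotient Y),
      t = quadraticDualι I₂ Y * u + algSection I₂ hl (TensorPower.toTensorAlgebra x) := by
  rw [quadraticDualPiece_eq, pow_succ] at ht
  induction ht using Submodule.mul_induction_on' with
  | add a _ b _ ha hb =>
    obtain ⟨u, hu, x, rfl⟩ := ha
    obtain ⟨u', hu', x', rfl⟩ := hb
    refine ⟨u + u', add_mem hu hu', x + x', ?_⟩
    simp only [mul_add, map_add]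
    abel
  | mem_mul_mem a ha b hb =>
    obtain ⟨z, rfl⟩ := hb
    set w := dualMk Y z
    -- The last factor z splits into l(z) Y and its section part; centrality moves Y to the front.
    have hab : a * quadraticDualι I₂ z = quadraticDualι I₂ Y * (l z • a) +
        a * algSection I₂ hl (TensorAlgebra.ι k w) := by
      rw [quadraticDualι_eq hl z, mul_add, mul_smul_comm, mul_smul_comm,
        (commute_quadraticDualι h a).eq]
    rw [← quadraticDualPiece_eq] at ha
    cases i with
    | zero =>
      obtain ⟨x, hx⟩ := exists_eq_algSection hl ha
      refine ⟨l z • a, Submodule.smul_mem _ _ ha,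
        TensorPower.mulEquiv (x ⊗ₜ PiTensorProduct.tprod k fun _ : Fin 1 => w), ?_⟩
      rw [hab, ← toTensorAlgebra_mul_ι, map_mul, ← hx]
    | succ i =>
      obtain ⟨u, hu, x, hx⟩ := exists_eq_mul_add_algSection h hl ha
      refine ⟨l z • a + u * algSection I₂ hl (TensorAlgebra.ι k w),
        add_mem (Submodule.smul_mem _ _ ha) ?_,
        TensorPower.mulEquiv (x ⊗ₜ PiTensorProduct.tprod k fun _ : Fin 1 => w), ?_⟩
      · rw [quadraticDualPiece_eq] at hu ⊢
        rw [pow_succ]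
        exact Submodule.mul_mem_mul hu (algSection_ι_mem hl w)
      · rw [hab, ← toTensorAlgebra_mul_ι, map_mul]
        have hx' : a * algSection I₂ hl (TensorAlgebra.ι k w) =
            quadraticDualι I₂ Y * (u * algSection I₂ hl (TensorAlgebra.ι k w)) +
              algSection I₂ hl (TensorPower.toTensorAlgebra x) *
                algSection I₂ hl (TensorAlgebra.ι k w) := by
          rw [hx, add_mul, mul_assoc]
        rw [hx', mul_add, add_assoc]

theorem list_prod_mem_pow_length {A : Type*} [Semiring A] [Algebra k A] {P : Submodule k A}
    {L : List A} (hL : ∀ a ∈ L, a ∈ P) : L.prod ∈ P ^ L.length := by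
  induction L with
  | nil => exact Submodule.one_le.1 le_rfl
  | cons a L ih =>
    rw [List.prod_cons, List.length_cons, pow_succ']
    exact Submodule.mul_mem_mul (hL a List.mem_cons_self)
      (ih fun b hb => hL b (List.mem_cons_of_mem a hb))

theorem algSection_mem (hl : l Y = 1) {i : ℕ} (x : ⨂[k]^i (DualQuotient Y)) :
    algSection I₂ hl (TensorPower.toTensorAlgebra x) ∈ quadraticDualPiece I₂ i := by
  rw [quadraticDualPiece_eq]
  induction x using PiTensorProduct.induction_on with
  | add x y hx hy => rw [map_add, map_add]; exact add_mem hx hy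
  | smul_tprod r x =>
    rw [map_smul, map_smul]
    refine Submodule.smul_mem _ _ ?_
    rw [TensorPower.toTensorAlgebra_tprod, TensorAlgebra.tprod_apply, map_list_prod, List.map_ofFn]
    refine (congrArg (_ ∈ LinearMap.range (quadraticDualι I₂) ^ ·) List.length_ofFn).mp
      (list_prod_mem_pow_length fun a ha => ?_)
    obtain ⟨j, rfl⟩ := List.mem_ofFn.1 ha
    exact algSection_ι_mem hl _

/-- The projection `A^!_i → T^i(V^* / k Y)`. -/
noncomputable def pieceProjection (h : HasCentralRelations I₂ Y) (i : ℕ) :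
    quadraticDualPiece I₂ i →ₗ[k] ⨂[k]^i (DualQuotient Y) :=
  tensorComponent k _ i ∘ₗ (dualProjection h).toLinearMap ∘ₗ (quadraticDualPiece I₂ i).subtype

/-- The piece projection extracts a graded component, so it is evaluated by exhibiting the image as
a homogeneous tensor. -/
theorem pieceProjection_eq (h : HasCentralRelations I₂ Y) {i : ℕ} {t : quadraticDualPiece I₂ i}
    {x : ⨂[k]^i (DualQuotient Y)}
    (ht : dualProjection h t = TensorPower.toTensorAlgebra x) : pieceProjection h i t = x := by
  rw [pieceProjection, LinearMap.comp_apply, LinearMap.comp_apply, Submodule.subtype_apply,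
    AlgHom.toLinearMap_apply, ht, tensorComponent_toTensorAlgebra]

theorem pieceProjection_surjective (h : HasCentralRelations I₂ Y) (hl : l Y = 1) (i : ℕ) :
    Function.Surjective (pieceProjection h i) := fun x =>
  ⟨⟨_, algSection_mem hl x⟩, pieceProjection_eq h (dualProjection_algSection h hl _)⟩

/-- Taking the component loses nothing: by the decomposition of A^!_i, the image is homogeneous of
degree i once the multiple of Y is killed. -/
theorem toTensorAlgebra_pieceProjection (h : HasCentralRelations I₂ Y) (hl : l Y = 1) {i : ℕ}
    (t : quadraticDualPiece I₂ i) :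
    TensorPower.toTensorAlgebra (pieceProjection h i t) = dualProjection h t := by
  obtain ⟨x, hx⟩ : ∃ x : ⨂[k]^i (DualQuotient Y),
      dualProjection h t = TensorPower.toTensorAlgebra x := by
    cases i with
    | zero =>
      obtain ⟨x, hx⟩ := exists_eq_algSection hl t.2
      exact ⟨x, by rw [hx, dualProjection_algSection]⟩
    | succ i =>
      obtain ⟨u, -, x, hx⟩ := exists_eq_mul_add_algSection h hl t.2
      exact ⟨x, by rw [hx, map_add, map_mul, dualProjection_ι_self, zero_mul, zero_add,
        dualProjection_algSection]⟩
  rw [pieceProjection_eq h hx, hx]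

/-! ### Equivariance, and the class of A^!_i as a geometric sum. -/

section Representation

variable {G : Type v} [Group G] (ρ : Representation k G V)

/-- The representation of `G` on `V^* / k Y`, for a `G`-invariant `Y`. -/
noncomputable def dualQuotientRep (hY : ∀ g, ρ.dual g Y = Y) :
    Representation k G (DualQuotient Y) :=
  ρ.dual.quotient (Submodule.span k {Y}) fun g => by
    rw [Submodule.span_singleton_le_iff_mem, Submodule.mem_comap, hY]
    exact Submodule.mem_span_singleton_self Y

theorem dualQuotientRep_dualMk (hY : ∀ g, ρ.dual g Y = Y) (g : G) (z : Module.Dual k V) :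
    dualQuotientRep ρ hY g (dualMk Y z) =
      dualMk Y (ρ.dual g z) := rfl

/-- The sequence is 0 → k → V^* → V^*/kY → 0 with 1 ↦ Y; the condition l(Y) = 1 makes the first map
injective. -/
theorem repClass_dualQuotientRep [Module.Finite k V] (hl : l Y = 1) (hY : ∀ g, ρ.dual g Y = Y) :
    repClass ρ.dual = 1 + repClass (dualQuotientRep ρ hY) := by
  rw [← repClass_trivial]
  refine repClass_eq_add (LinearMap.toSpanSingleton k _ Y) (dualMk Y)
    (fun g c => ?_) (fun g z => rfl) (fun a b hab => ?_) (fun z => ?_)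
    (dualMk_surjective Y)
  · rw [Representation.trivial_apply, LinearMap.toSpanSingleton_apply, map_smul, hY]
  · simpa [hl] using congrArg l hab
  · rw [dualMk_eq_zero, Submodule.mem_span_singleton]
    rfl

variable (hI : ∀ g : G, ∀ q ∈ I₂, TensorProduct.map (ρ g) (ρ g) q ∈ I₂)

theorem quadraticDualAct_ι (g : G) (z : Module.Dual k V) :
    quadraticDualAct ρ hI g (quadraticDualι I₂ z) = quadraticDualι I₂ (ρ.dual g z) :=
  (quadraticDualAct_mk I₂ ρ hI g _).trans (congrArg _ (tensorDualAct_ι ρ g z))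

theorem dualProjection_quadraticDualAct (h : HasCentralRelations I₂ Y)
    (hY : ∀ g, ρ.dual g Y = Y) (g : G) (a : QuadraticDual I₂) :
    dualProjection h (quadraticDualAct ρ hI g a) =
      TensorAlgebra.lift k (TensorAlgebra.ι k ∘ₗ dualQuotientRep ρ hY g)
        (dualProjection h a) := by
  have : (dualProjection h).comp (quadraticDualAct ρ hI g) =
      (TensorAlgebra.lift k (TensorAlgebra.ι k ∘ₗ dualQuotientRep ρ hY g)).comp
        (dualProjection h) := by
    refine quadraticDual_algHom_ext fun z => ?_
    rw [AlgHom.comp_apply, AlgHom.comp_apply, quadraticDualAct_ι, dualProjection_ι,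
      dualProjection_ι, TensorAlgebra.lift_ι_apply, LinearMap.comp_apply, dualQuotientRep_dualMk]
  exact AlgHom.congr_fun this a

/-- The projection does not depend on l, so it is equivariant although l and the section need not
be. -/
theorem pieceProjection_rep (h : HasCentralRelations I₂ Y) (hl : l Y = 1)
    (hY : ∀ g, ρ.dual g Y = Y) (i : ℕ) (g : G)
    (t : (quadraticDualPieceRep I₂ ρ hI i).toSubmodule) :
    pieceProjection h i ((quadraticDualPieceRep I₂ ρ hI i).toRepresentation g t) =
      tensorPowerRep (dualQuotientRep ρ hY) i g (pieceProjection h i t) := by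
  refine pieceProjection_eq h ?_
  rw [toTensorAlgebra_tensorPowerRep]
  erw [toTensorAlgebra_pieceProjection h hl]
  exact dualProjection_quadraticDualAct ρ hI h hY g t

variable [Module.Finite k V]

theorem subrepClass_quadraticDualPieceRep_zero (h : HasCentralRelations I₂ Y) (hl : l Y = 1)
    (hY : ∀ g, ρ.dual g Y = Y) :
    subrepClass (quadraticDualPieceRep I₂ ρ hI 0) = 1 := by
  rw [← pow_zero (repClass (dualQuotientRep ρ hY)), ← repClass_tensorPowerRep]
  refine repClass_congr (LinearEquiv.ofBijective (pieceProjection h 0)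
    ⟨(injective_iff_map_eq_zero _).2 fun t ht => ?_, pieceProjection_surjective h hl 0⟩)
    (pieceProjection_rep ρ hI h hl hY 0)
  obtain ⟨x, hx⟩ := exists_eq_algSection hl t.2
  have h0 : pieceProjection h 0 t = x :=
    pieceProjection_eq h (by rw [hx, dualProjection_algSection])
  ext
  rw [hx, ← h0, ht, map_zero, map_zero, Submodule.coe_zero]

/-- The class of 0 → A^!_i → A^!_{i+1} → T^{i+1}(V^*/kY) → 0, whose first map is multiplication by
the invariant element Y. -/
theorem subrepClass_quadraticDualPieceRep_succ (h : HasCentralRelations I₂ Y) (hl : l Y = 1)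
    (hY : ∀ g, ρ.dual g Y = Y) (i : ℕ) :
    subrepClass (quadraticDualPieceRep I₂ ρ hI (i + 1)) =
      subrepClass (quadraticDualPieceRep I₂ ρ hI i) +
        repClass (dualQuotientRep ρ hY) ^ (i + 1) := by
  rw [← repClass_tensorPowerRep]
  have hmul (u) (hu : u ∈ quadraticDualPiece I₂ i) :
      LinearMap.mulLeft k (quadraticDualι I₂ Y) u ∈ quadraticDualPiece I₂ (i + 1) := by
    rw [quadraticDualPiece_eq] at hu ⊢
    rw [pow_succ']
    exact Submodule.mul_mem_mul ⟨Y, rfl⟩ hu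
  refine repClass_eq_add ((LinearMap.mulLeft k (quadraticDualι I₂ Y)).restrict hmul)
    (pieceProjection h (i + 1)) (fun g u => ?_) (pieceProjection_rep ρ hI h hl hY (i + 1))
    (fun a b hab => ?_) (fun t => ⟨fun ht => ?_, ?_⟩) (pieceProjection_surjective h hl (i + 1))
  · ext
    change _ = quadraticDualAct ρ hI g (quadraticDualι I₂ Y * u)
    rw [map_mul, quadraticDualAct_ι, hY]
    rfl
  · exact Subtype.ext (quadraticDualι_mul_injective h hl (congrArg Subtype.val hab))
  · obtain ⟨u, hu, x, hx⟩ := exists_eq_mul_add_algSection h hl t.2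
    have h0 : pieceProjection h (i + 1) t = x := pieceProjection_eq h (by
      rw [hx, map_add, map_mul, dualProjection_ι_self, zero_mul, zero_add,
        dualProjection_algSection])
    refine ⟨⟨u, hu⟩, Subtype.ext ?_⟩
    have hx0 : x = 0 := h0.symm.trans ht
    rw [hx, hx0, map_zero, map_zero, add_zero]
    rfl
  · rintro ⟨u, rfl⟩
    refine pieceProjection_eq h ?_
    rw [map_zero]
    change dualProjection h (quadraticDualι I₂ Y * u) = 0
    rw [map_mul, dualProjection_ι_self, zero_mul]

theorem subrepClass_quadraticDualPieceRep (h : HasCentralRelations I₂ Y) (hl : l Y = 1)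
    (hY : ∀ g, ρ.dual g Y = Y) (i : ℕ) :
    subrepClass (quadraticDualPieceRep I₂ ρ hI i) =
      ∑ j ∈ Finset.range (i + 1), repClass (dualQuotientRep ρ hY) ^ j := by
  induction i with
  | zero => simp [subrepClass_quadraticDualPieceRep_zero ρ hI h hl hY]
  | succ i ih =>
    rw [subrepClass_quadraticDualPieceRep_succ ρ hI h hl hY, ih, Finset.sum_range_succ _ (i + 1)]

end Representation

end CentralElement

/-! ### The uniform matroid of rank two: the relations of A^! and the reflection class. -/

section RankTwo

variable (k : Type u) [Field k] {n : ℕ}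

/-- The generator `x_a` of the Orlik-Solomon algebra, as an element of `V`. -/
noncomputable def varX (a : Fin n) : VarSpace k (Fin n) := MonoidAlgebra.single a 1

variable {k} in
theorem varSpace_hom_ext {B : Type*} [AddCommMonoid B] [Module k B]
    {f g : VarSpace k (Fin n) →ₗ[k] B} (h : ∀ a, f (varX k a) = g (varX k a)) : f = g :=
  (MonoidAlgebra.basis (Fin n) k).ext fun a => h a

variable (n) in
/-- The element `Y = ∑ y_a` of `V^*`, where `y_a` is the basis dual to `x_a`. -/
noncomputable def coordSum : Module.Dual k (VarSpace k (Fin n)) where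
  toFun x := ∑ j, x.coeff j
  map_add' x y := by simp [Finset.sum_add_distrib]
  map_smul' c x := by simp [Finset.mul_sum]

theorem coordSum_varX (a : Fin n) : coordSum k n (varX k a) = 1 := by
  change ∑ j, (MonoidAlgebra.single a 1 : VarSpace k (Fin n)).coeff j = 1
  simp

theorem ofMulAction_varX (g : Equiv.Perm (Fin n)) (a : Fin n) :
    Representation.ofMulAction k (Equiv.Perm (Fin n)) (Fin n) g (varX k a) = varX k (g a) := by
  simp [varX]

theorem dual_coordSum (g : Equiv.Perm (Fin n)) :
    (Representation.ofMulAction k (Equiv.Perm (Fin n)) (Fin n)).dual g (coordSum k n) =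
      coordSum k n := by
  refine varSpace_hom_ext fun a => ?_
  rw [coordSum_varX]
  exact (congrArg _ (ofMulAction_varX k g⁻¹ a)).trans (coordSum_varX k _)

theorem osBoundary_three (a b c : Fin n) :
    osBoundary k ![a, b, c] =
      ExteriorAlgebra.ι k (varX k b) * ExteriorAlgebra.ι k (varX k c) -
        ExteriorAlgebra.ι k (varX k a) * ExteriorAlgebra.ι k (varX k c) +
        ExteriorAlgebra.ι k (varX k a) * ExteriorAlgebra.ι k (varX k b) := by
  have h (f : Fin 2 → VarSpace k (Fin n)) : ExteriorAlgebra.ιMulti k 2 f =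
      ExteriorAlgebra.ι k (f 0) * ExteriorAlgebra.ι k (f 1) := by
    simp [ExteriorAlgebra.ιMulti_apply]
    rfl
  rw [osBoundary, Fin.sum_univ_three, h, h, h]
  change (-1 : k) ^ 0 • (ExteriorAlgebra.ι k (varX k b) * ExteriorAlgebra.ι k (varX k c)) +
    (-1 : k) ^ 1 • (ExteriorAlgebra.ι k (varX k a) * ExteriorAlgebra.ι k (varX k c)) +
    (-1 : k) ^ 2 • (ExteriorAlgebra.ι k (varX k a) * ExteriorAlgebra.ι k (varX k b)) = _
  simp [sub_eq_add_neg]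

theorem uniformMatroid_isCircuit_range {m : ℕ} {c : Fin (m + 1) → Fin n}
    (hc : Function.Injective c) :
    (uniformMatroid 2 n).IsCircuit (Set.range c) ↔ m = 2 := by
  rw [uniformMatroid_isCircuit_iff, ← Set.image_univ, Set.ncard_image_of_injective _ hc]
  simp

variable {k} in
theorem mem_quadraticPart_iff (q : VarSpace k (Fin n) ⊗[k] VarSpace k (Fin n)) :
    q ∈ quadraticPart (osPresentation k (uniformMatroid 2 n)) ↔
      RingQuot.mkAlgHom k (OSRel k (uniformMatroid 2 n))
        (TensorAlgebra.toExterior (degreeTwo k _ q)) = 0 := Iff.rfl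

theorem toExterior_degreeTwo (v w : VarSpace k (Fin n)) :
    TensorAlgebra.toExterior (degreeTwo k _ (v ⊗ₜ w)) =
      ExteriorAlgebra.ι k v * ExteriorAlgebra.ι k w := by
  simp [degreeTwo]

/-- This and the next two lemmas supply enough elements of I₂ to force an annihilating p into
commutator form. That they span I₂ is never needed: the converse is obtained from the matrix
representation `detect`. -/
theorem tmul_self_mem_quadraticPart (v : VarSpace k (Fin n)) :
    v ⊗ₜ[k] v ∈ quadraticPart (osPresentation k (uniformMatroid 2 n)) := by
  rw [mem_quadraticPart_iff, toExterior_degreeTwo, ExteriorAlgebra.ι_sq_zero, map_zero]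

theorem tmul_add_tmul_mem_quadraticPart (v w : VarSpace k (Fin n)) :
    v ⊗ₜ[k] w + w ⊗ₜ[k] v ∈ quadraticPart (osPresentation k (uniformMatroid 2 n)) := by
  rw [mem_quadraticPart_iff, map_add, map_add, toExterior_degreeTwo, toExterior_degreeTwo,
    ExteriorAlgebra.ι_add_mul_swap, map_zero]

theorem boundary_mem_quadraticPart {a b c : Fin n} (hab : a ≠ b) (hac : a ≠ c) (hbc : b ≠ c) :
    varX k b ⊗ₜ[k] varX k c - varX k a ⊗ₜ[k] varX k c + varX k a ⊗ₜ[k] varX k b ∈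
      quadraticPart (osPresentation k (uniformMatroid 2 n)) := by
  have hinj : Function.Injective ![a, b, c] := by
    intro i j
    fin_cases i <;> fin_cases j <;> simp [hab, hac, hbc, hab.symm, hac.symm, hbc.symm]
  have := RingQuot.mkAlgHom_rel k (OSRel.of (k := k) (M := uniformMatroid 2 n) ![a, b, c] hinj
    ((uniformMatroid_isCircuit_range hinj).2 rfl))
  rw [mem_quadraticPart_iff]
  simp only [map_add, map_sub, toExterior_degreeTwo]
  rw [map_zero, osBoundary_three] at this
  simpa only [map_add, map_sub] using this

/-! ### A matrix representation showing that the commutators annihilate I₂. -/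

section Detection

variable {k} (z : Module.Dual k (VarSpace k (Fin n)))

/-- A linear map to `4 × 4` matrices which detects the products of degree two. -/
noncomputable def detectLinear :
    VarSpace k (Fin n) →ₗ[k] Matrix (Fin 4) (Fin 4) k :=
  (coordSum k n).smulRight (Matrix.single 0 1 1 - Matrix.single 2 3 1) +
    z.smulRight (Matrix.single 0 2 1 + Matrix.single 1 3 1)

/-- The first row of the matrix of v is (0, Y(v), z(v), 0), its last column is (0, z(v), -Y(v), 0),
and all else is zero, so only the corner of a product survives. The corner is alternating in v and
w, hence defined on the exterior algebra, and it kills circuit boundaries because Y(x_a) = 1. -/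
theorem detectLinear_mul (v w : VarSpace k (Fin n)) :
    detectLinear z v * detectLinear z w =
      (coordSum k n v * z w - z v * coordSum k n w) • Matrix.single 0 3 1 := by
  ext i j
  fin_cases i <;> fin_cases j <;>
    simp [detectLinear, Matrix.mul_apply, Fin.sum_univ_four, Matrix.single_apply, sub_eq_add_neg]

/-- The algebra homomorphism from the Orlik-Solomon algebra to `4 × 4` matrices given by
`detectLinear`. -/
noncomputable def detect :
    OrlikSolomonAlgebra k (uniformMatroid 2 n) →ₐ[k] Matrix (Fin 4) (Fin 4) k :=
  RingQuot.liftAlgHom k ⟨ExteriorAlgebra.lift k ⟨detectLinear z, fun v => by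
    rw [detectLinear_mul, mul_comm, sub_self, zero_smul]⟩, by
    rintro _ _ ⟨c, hc, hC⟩
    obtain rfl := (uniformMatroid_isCircuit_range hc).1 hC
    have h : c = ![c 0, c 1, c 2] := by
      ext i
      fin_cases i <;> rfl
    rw [h, osBoundary_three]
    simp only [map_add, map_sub, map_mul, ExteriorAlgebra.lift_ι_apply, detectLinear_mul,
      coordSum_varX, map_zero]
    module⟩

theorem detect_degreeTwo (q : VarSpace k (Fin n) ⊗[k] VarSpace k (Fin n)) :
    detect z (osPresentation k (uniformMatroid 2 n) (degreeTwo k _ q)) =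
      TensorProduct.dualDistrib k _ _ (coordSum k n ⊗ₜ z - z ⊗ₜ coordSum k n) q •
        Matrix.single 0 3 1 := by
  induction q with
  | zero => simp
  | add a b ha hb => simp only [map_add, ha, hb, add_smul]
  | tmul v w =>
    have h : osPresentation k (uniformMatroid 2 n) (degreeTwo k _ (v ⊗ₜ w)) =
        RingQuot.mkAlgHom k (OSRel k (uniformMatroid 2 n))
          (ExteriorAlgebra.ι k v * ExteriorAlgebra.ι k w) :=
      congrArg _ (toExterior_degreeTwo k v w)
    rw [h, detect, RingQuot.liftAlgHom_mkAlgHom_apply, map_mul, ExteriorAlgebra.lift_ι_apply,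
      ExteriorAlgebra.lift_ι_apply, detectLinear_mul, map_sub, LinearMap.sub_apply,
      TensorProduct.dualDistrib_apply, TensorProduct.dualDistrib_apply]

theorem dualDistrib_commutator_eq_zero {q : VarSpace k (Fin n) ⊗[k] VarSpace k (Fin n)}
    (hq : q ∈ quadraticPart (osPresentation k (uniformMatroid 2 n))) :
    TensorProduct.dualDistrib k _ _ (coordSum k n ⊗ₜ z - z ⊗ₜ coordSum k n) q = 0 := by
  have h := detect_degreeTwo z q
  have hq' : osPresentation k (uniformMatroid 2 n) (degreeTwo k _ q) = 0 := hq
  rw [hq', map_zero] at h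
  simpa using (congrFun (congrFun h 0) 3).symm

end Detection

/-- For the uniform matroid of rank two, `A^!` is the algebra generated by `V^*` subject to the
relations that `Y = ∑ y_a` is central. -/
theorem hasCentralRelations (hn : 0 < n) :
    HasCentralRelations (quadraticPart (osPresentation k (uniformMatroid 2 n)))
      (coordSum k n) := by
  intro p
  refine ⟨fun hp => ?_, ?_⟩
  · set P : Fin n → Fin n → k := fun a b =>
      TensorProduct.dualDistrib k _ _ p (varX k a ⊗ₜ varX k b) with hP
    have h1 (a) : P a a = 0 := hp _ (tmul_self_mem_quadraticPart k _)
    have h2 (a b) : P a b + P b a = 0 := by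
      simpa using hp _ (tmul_add_tmul_mem_quadraticPart k (varX k a) (varX k b))
    have h3 {a b c} (hab : a ≠ b) (hac : a ≠ c) (hbc : b ≠ c) : P b c - P a c + P a b = 0 := by
      simpa using hp _ (boundary_mem_quadraticPart k hab hac hbc)
    let o : Fin n := ⟨0, hn⟩
    -- The circuit relation is a cocycle condition on P; taking o as base point makes P a
    -- coboundary. Coincidences among o, a, b are handled by the alternating property.
    have h4 (a b) : P a b = P o b - P o a := by
      by_cases hoa : o = a
      · rw [← hoa, h1, sub_zero]
      by_cases hob : o = b
      · rw [← hob, h1]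
        linear_combination h2 a o
      by_cases hab : a = b
      · rw [hab, h1, sub_self]
      · linear_combination h3 hoa hob hab
    -- On (x_a, x_b), Y ⊗ z - z ⊗ Y takes the value z(x_b) - z(x_a), so z must have the values P o
    -- a. Testing on basis tensors suffices since V is finite-dimensional.
    let z : Module.Dual k (VarSpace k (Fin n)) :=
      (MonoidAlgebra.basis (Fin n) k).constr k (P o)
    have hz (a) : z (varX k a) = P o a := (MonoidAlgebra.basis (Fin n) k).constr_basis k _ a
    refine ⟨z, (TensorProduct.dualDistribEquiv k (VarSpace k (Fin n))
      (VarSpace k (Fin n))).injective ?_⟩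
    change TensorProduct.dualDistrib k _ _ p = TensorProduct.dualDistrib k _ _ _
    refine TensorProduct.ext (varSpace_hom_ext fun a => varSpace_hom_ext fun b => ?_)
    change P a b = TensorProduct.dualDistrib k _ _
      (coordSum k n ⊗ₜ z - z ⊗ₜ coordSum k n) (varX k a ⊗ₜ varX k b)
    rw [map_sub, LinearMap.sub_apply, TensorProduct.dualDistrib_apply,
      TensorProduct.dualDistrib_apply, coordSum_varX, coordSum_varX, hz, hz, one_mul, mul_one, h4]
  · rintro ⟨z, rfl⟩ q hq
    exact dualDistrib_commutator_eq_zero z hq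

/-- S^(n-1,1) is the kernel of the invariant functional Y, which is onto as soon as a basis vector
exists. -/
theorem repClass_ofMulAction (hn : 0 < n) :
    repClass (Representation.ofMulAction k (Equiv.Perm (Fin n)) (Fin n)) =
      reflectionClass k n + 1 := by
  rw [← repClass_trivial]
  refine repClass_eq_add (reflectionRep k n).toSubmodule.subtype (coordSum k n)
    (fun g x => rfl) (fun g x => ?_) (Submodule.subtype_injective _) (fun x => ?_) fun r => ?_
  · have h : coordSum k n (Representation.ofMulAction k _ _ g⁻¹⁻¹ x) = coordSum k n x :=
      LinearMap.congr_fun (dual_coordSum k g⁻¹) x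
    rwa [inv_inv] at h
  · exact ⟨fun h => ⟨⟨x, h⟩, rfl⟩, by rintro ⟨y, rfl⟩; exact y.2⟩
  · exact ⟨r • varX k ⟨0, hn⟩, by rw [map_smul, coordSum_varX, smul_eq_mul, mul_one]⟩

/-- A permutation module is self-dual: the group permutes the dual basis in the same way. -/
theorem repClass_dual_ofMulAction :
    repClass (Representation.ofMulAction k (Equiv.Perm (Fin n)) (Fin n)).dual =
      repClass (Representation.ofMulAction k (Equiv.Perm (Fin n)) (Fin n)) := by
  symm
  let b := MonoidAlgebra.basis (Fin n) k
  have hb (c d : Fin n) : b.toDualEquiv (varX k c) (varX k d) = if c = d then 1 else 0 :=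
    b.toDual_apply c d
  refine repClass_congr b.toDualEquiv fun g x => ?_
  have : b.toDualEquiv.toLinearMap ∘ₗ Representation.ofMulAction k (Equiv.Perm (Fin n)) (Fin n) g =
      (Representation.ofMulAction k (Equiv.Perm (Fin n)) (Fin n)).dual g ∘ₗ
        b.toDualEquiv.toLinearMap := by
    refine varSpace_hom_ext fun c => varSpace_hom_ext fun d => ?_
    change b.toDualEquiv (Representation.ofMulAction k _ _ g (varX k c)) (varX k d) =
      b.toDualEquiv (varX k c) (Representation.ofMulAction k _ _ g⁻¹ (varX k d))
    rw [ofMulAction_varX, ofMulAction_varX, hb, hb]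
    simp only [Equiv.Perm.eq_inv_iff_eq]
  exact LinearMap.congr_fun this x

theorem reflectionClass_eq (hn : 0 < n) : reflectionClass k n = hookClass k n 1 - 1 := by
  rw [hookClass_one, permClass, repClass_ofMulAction k hn, add_sub_cancel_right]

theorem osDualClass_uniformMatroid (hn : 0 < n) (i : ℕ) :
    osDualClass k (uniformMatroid_acts 2 n) i =
      ∑ j ∈ Finset.range (i + 1), reflectionClass k n ^ j := by
  -- Evaluation at one basis vector gives l(Y) = 1 in every characteristic; averaging over all of
  -- them would require n to be invertible.
  let l : Module.Dual k (VarSpace k (Fin n)) →ₗ[k] k :=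
    Module.Dual.eval k _ (varX k ⟨0, hn⟩)
  have hl : l (coordSum k n) = 1 := coordSum_varX k _
  -- The two modules are compared only through classes: 1 + [V^*/kY] = [V^*] = [V] = [S^(n-1,1)] +
  -- 1.
  have hW : repClass (dualQuotientRep _ (dual_coordSum k (n := n))) = reflectionClass k n := by
    have h := repClass_dualQuotientRep _ hl (dual_coordSum k)
    rw [repClass_dual_ofMulAction, repClass_ofMulAction k hn, add_comm] at h
    exact (add_left_cancel h).symm
  rw [← hW]
  exact subrepClass_quadraticDualPieceRep _ _ (hasCentralRelations k hn) hl (dual_coordSum k) i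

end RankTwo

end RankTwoOS

theorem mainTheorem12 {k : Type*} [Field k] (n i : ℕ) (hn : 2 ≤ n) :
    RankTwoOS.osDualClass k (RankTwoOS.uniformMatroid_acts 2 n) i =
        ∑ j ∈ Finset.range (i + 1), RankTwoOS.reflectionClass k n ^ j ∧
    (∃ (X : Type) (_ : Finite X) (_ : MulAction (Equiv.Perm (Fin n)) X),
      RankTwoOS.osDualClass k (RankTwoOS.uniformMatroid_acts 2 n) i =
        RankTwoOS.permClass k (Equiv.Perm (Fin n)) X) ∧
    (Even i →
      RankTwoOS.osDualClass k (RankTwoOS.uniformMatroid_acts 2 n) i =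
        RankTwoOS.youngClass k n [n] +
          ∑ d ∈ Finset.Icc 2 i, RankTwoOS.evenCoeff d i • RankTwoOS.hookClass k n d) ∧
    (Odd i →
      RankTwoOS.osDualClass k (RankTwoOS.uniformMatroid_acts 2 n) i =
        RankTwoOS.youngClass k n [n - 1, 1] +
          ∑ d ∈ Finset.Icc 2 i, RankTwoOS.oddCoeff d i • RankTwoOS.hookClass k n d) ∧
    (∀ d ∈ Finset.Icc 2 i,
      (Even i → 0 < RankTwoOS.evenCoeff d i) ∧ (Odd i → 0 < RankTwoOS.oddCoeff d i)) := by
  have hsum := RankTwoOS.osDualClass_uniformMatroid k (n := n) (by omega) i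
  have hgeom := hsum
  rw [RankTwoOS.reflectionClass_eq k (by omega)] at hgeom
  have heven (hi : Even i) := hgeom.trans (RankTwoOS.geom_sum_hookClass_of_even k n hi)
  have hodd (hi : Odd i) := hgeom.trans (RankTwoOS.geom_sum_hookClass_of_odd k n (by omega) hi)
  -- Natural coefficients are what make the expansions classes of actual G-sets; the leading term is
  -- one by definition.
  have hhook (c : ℕ → ℕ) : RankTwoOS.IsPermClass k (Equiv.Perm (Fin n))
      (∑ d ∈ Finset.Icc 2 i, c d • RankTwoOS.hookClass k n d) :=
    RankTwoOS.IsPermClass.sum _ fun d _ => (RankTwoOS.isPermClass_hookClass k n d).nsmul (c d)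
  refine ⟨hsum, ?_, heven, hodd, fun d hd =>
    ⟨RankTwoOS.evenCoeff_pos hd, RankTwoOS.oddCoeff_pos hd⟩⟩
  rcases Nat.even_or_odd i with hi | hi
  · rw [heven hi]
    exact RankTwoOS.IsPermClass.add ⟨_, inferInstance, inferInstance, rfl⟩ (hhook _)
  · rw [hodd hi]
    exact RankTwoOS.IsPermClass.add ⟨_, inferInstance, inferInstance, rfl⟩ (hhook _)
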